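/- Let $a<t<b$, $T=b-a$, $\sigma>0$, and let $u$ be analytic and $T$-periodic in the strip $D_\sigma=\{z\in\mathbb C:|\operatorname{Im}z|<\sigma\}$. Put $$K(z)=\frac{\cos\frac{\pi(z-t)}{T}}{\sin^3\frac{\pi(z-t)}{T}},\qquad f(x)=K(x)u(x),$$ and let $g$ be the function $(x-t)^3f(x)$, extended continuously to $x=t$; it is $C^\infty$ on $[a,b]$. Let $I[f]$ be the Hadamard finite part of $\int_a^b f(x)\,dx$, i.e. the constant term that remains, as $\varepsilon\to0^+$, after the divergent terms in $\log\varepsilon,\ \varepsilon^{-1},\ \varepsilon^{-2}$ of $\int_a^{t-\varepsilon}f+\int_{t+\varepsilon}^b f$ are discarded; it exists. For $n\ge 1$ and $h=T/n$ let $$\widehat T^{(0)}_n[f]=h\sum_{j=1}^{n-1}f(t+jh)-\frac{\pi^2}{3}g'(t)h^{-1}+\frac16 g'''(t)h,$$ $$\widehat T^{(1)}_n[f]=h\sum_{j=1}^{n}f\big(t+jh-\tfrac h2\big)-\pi^2g'(t)h^{-1},$$ $$\widehat T^{(2)}_n[f]=2h\sum_{j=1}^{n}f\big(t+jh-\tfrac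 h2\big)-\frac h2\sum_{j=1}^{2n}f\big(t+\tfrac{jh}2-\tfrac h4\big),$$ and $E^{(s)}_n=\widehat T^{(s)}_n[f]-I[f]$ for $s=0,1,2$. Let $$F_1(z)=K(z)\Big[u(z)-u(t)-\frac T\pi u'(t)\tan\frac{\pi(z-t)}T-\frac{T^2}{2\pi^2}u''(t)\sin^2\frac{\pi(z-t)}T\Big].$$ After removal of its removable singularities, $F_1$ is analytic and $T$-periodic in $D_\sigma$. For $\tau\in(0,\sigma)$ and $n\ge 1$ put $$M(\tau)=\max_{x\in\mathbb R}|F_1(x+i\tau)|+\max_{x\in\mathbb R}|F_1(x-i\tau)|,\qquad \phi_n(\tau)=\frac{e^{-2n\pi\tau/T}}{1-e^{-2n\pi\tau/T}},$$ where the maxima are attained. Then, for every $n\ge1$ and every $\tau\in(0,\sigma)$, $$|E^{(0)}_n|\le TM(\tau)\,\phi_n(\tau),$$ $$|E^{(1)}_n|\le TM(\tau)\,[\phi_n(\tau)+2\phi_{2n}(\tau)],$$ $$|E^{(2)}_n|\le TM(\tau)\,[2\phi_n(\tau)+5\phi_{2n}(\tau)+2\phi_{4n}(\tau)].$$ In particular,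 for each $s\in\{0,1,2\}$ and every $\tau\in(0,\sigma)$, $E^{(s)}_n=O(e^{-2n\pi\tau/T})$ as $n\to\infty$. -/

import Mathlib

open Set Filter Topology MeasureTheory
open scoped ContDiff

noncomputable section

namespace Supersingular

/-- The open strip `|Im z| < σ` of the complex plane. -/
def strip (σ : ℝ) : Set ℂ := {z | |z.im| < σ}

/-- The kernel `K(z) = cos (π (z - t) / T) / sin³ (π (z - t) / T)`. -/
def kernel (T t : ℝ) (z : ℂ) : ℂ :=
  Complex.cos (Real.pi * (z - t) / T) / Complex.sin (Real.pi * (z - t) / T) ^ 3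

/-- The integrand `f(x) = K(x) u(x)` on the real line. -/
def integrand (T t : ℝ) (u : ℂ → ℂ) (x : ℝ) : ℂ := kernel T t x * u x

/-- `I` is the Hadamard finite part of `∫ x in a..b, f x`, where `f` has a singularity of order at
most three at the interior point `t`: the constant term that remains, as `ε → 0+`, after the
divergent terms `log ε`, `1 / ε`, `1 / ε ^ 2` of the integral of `f` over
`[a, t - ε] ∪ [t + ε, b]` have been discarded. -/
def HasFinitePart (f : ℝ → ℂ) (a b t : ℝ) (I : ℂ) : Prop :=
  (∀ᶠ ε : ℝ in 𝓝[>] 0,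
    IntervalIntegrable f volume a (t - ε) ∧ IntervalIntegrable f volume (t + ε) b) ∧
  ∃ c₀ c₁ c₂ : ℂ, Tendsto
    (fun ε : ℝ => (∫ x in a..(t - ε), f x) + (∫ x in (t + ε)..b, f x)
      - (c₀ * (Real.log ε : ℂ) + c₁ / (ε : ℂ) + c₂ / (ε : ℂ) ^ 2))
    (𝓝[>] 0) (𝓝 I)

/-- The finite part is unique. -/
theorem HasFinitePart.unique {f : ℝ → ℂ} {a b t : ℝ} {I J : ℂ}
    (hI : HasFinitePart f a b t I) (hJ : HasFinitePart f a b t J) : I = J := by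
  obtain ⟨-, c₀, c₁, c₂, hc⟩ := hI
  obtain ⟨-, d₀, d₁, d₂, hd⟩ := hJ
  have key : ∀ e₀ e₁ e₂ L : ℂ, Tendsto (fun ε : ℝ => e₀ * (Real.log ε : ℂ) + e₁ / (ε : ℂ)
      + e₂ / (ε : ℂ) ^ 2) (𝓝[>] 0) (𝓝 L) → L = 0 := by
    intro e₀ e₁ e₂ L h
    have hε : Tendsto (fun ε : ℝ => (ε : ℂ)) (𝓝[>] 0) (𝓝 0) := by
      have := (Complex.continuous_ofReal.tendsto 0).mono_left
        (nhdsWithin_le_nhds (s := Ioi (0 : ℝ)))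
      simpa using this
    have hl : Tendsto (fun ε : ℝ => (ε : ℂ) * (Real.log ε : ℂ)) (𝓝[>] 0) (𝓝 0) := by
      have h1 := tendsto_log_mul_rpow_nhdsGT_zero (r := 1) one_pos
      have := (Complex.continuous_ofReal.tendsto 0).comp h1
      refine (by simpa [Function.comp_def] using this :
        Tendsto (fun ε : ℝ => (Real.log ε : ℂ) * (ε : ℂ)) _ (𝓝 (0 : ℂ))).congr fun ε => ?_
      simp [mul_comm]
    have hne : ∀ᶠ ε : ℝ in 𝓝[>] 0, (ε : ℂ) ≠ 0 := by
      filter_upwards [self_mem_nhdsWithin] with ε h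
      exact_mod_cast (ne_of_gt h)
    have h2 : e₂ = 0 := by
      have A := (hε.pow 2).mul h
      have B := ((hε.mul hl).const_mul e₀).add (hε.const_mul e₁) |>.add_const e₂
      have q := tendsto_nhds_unique (A.congr' (by
        filter_upwards [hne] with ε h
        field_simp)) B
      simpa using q.symm
    subst h2
    have h1 : e₁ = 0 := by
      have A := hε.mul h
      have B := (hl.const_mul e₀).add_const e₁
      have q := tendsto_nhds_unique (A.congr' (by
        filter_upwards [hne] with ε h
        field_simp
        ring)) B
      simpa using q.symm
    subst h1
    have h0 : e₀ = 0 := by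
      by_contra hne0
      have A : Tendsto (fun ε : ℝ => (Real.log ε : ℂ)) (𝓝[>] 0) (𝓝 (e₀⁻¹ * L)) := by
        refine (h.const_mul e₀⁻¹).congr fun ε => ?_
        simp [hne0]
      have B := (Complex.continuous_re.tendsto _).comp A
      exact not_tendsto_nhds_of_tendsto_atBot Real.tendsto_log_nhdsGT_zero _
        (B.congr fun ε => by simp [Complex.ofReal_re])
    subst h0
    exact tendsto_nhds_unique h (by simp)
  have := key (d₀ - c₀) (d₁ - c₁) (d₂ - c₂) (I - J)
    ((hc.sub hd).congr fun ε => by ring)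
  exact sub_eq_zero.mp this

/-- The Hadamard finite part integral of `f` over `[a, b]` (arbitrary if there is none). -/
def finitePart (f : ℝ → ℂ) (a b t : ℝ) : ℂ := Classical.epsilon (HasFinitePart f a b t)

theorem HasFinitePart.finitePart_eq {f : ℝ → ℂ} {a b t : ℝ} {I : ℂ}
    (h : HasFinitePart f a b t I) : finitePart f a b t = I :=
  (Classical.epsilon_spec (p := HasFinitePart f a b t) ⟨I, h⟩ : HasFinitePart f a b t
    (finitePart f a b t)).unique h

/-- The regular factor `g` in `f(x) = g(x) / (x - t)³`: the function `(x - t)³ f(x)`, with its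
removable singularity at `x = t` filled in by its limit. -/
def regularFactor (f : ℝ → ℂ) (t : ℝ) : ℝ → ℂ :=
  Function.update (fun x : ℝ => ((x - t : ℝ) : ℂ) ^ 3 * f x) t
    (limUnder (𝓝[≠] t) (fun x : ℝ => ((x - t : ℝ) : ℂ) ^ 3 * f x))

/-- The quadrature formula `T̂⁽⁰⁾ₙ[f]`, with `h = T / n`. -/
def quad0 (T t : ℝ) (f : ℝ → ℂ) (n : ℕ) : ℂ :=
  let h : ℝ := T / n
  h * ∑ j ∈ Finset.Ico 1 n, f (t + j * h)
    - (Real.pi : ℂ) ^ 2 / 3 * deriv (regularFactor f t) t * (h : ℂ)⁻¹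
    + 1 / 6 * iteratedDeriv 3 (regularFactor f t) t * h

/-- The quadrature formula `T̂⁽¹⁾ₙ[f]`, with `h = T / n`. -/
def quad1 (T t : ℝ) (f : ℝ → ℂ) (n : ℕ) : ℂ :=
  let h : ℝ := T / n
  h * ∑ j ∈ Finset.Icc 1 n, f (t + j * h - h / 2)
    - (Real.pi : ℂ) ^ 2 * deriv (regularFactor f t) t * (h : ℂ)⁻¹

/-- The quadrature formula `T̂⁽²⁾ₙ[f]`, with `h = T / n`. -/
def quad2 (T t : ℝ) (f : ℝ → ℂ) (n : ℕ) : ℂ :=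
  let h : ℝ := T / n
  2 * h * ∑ j ∈ Finset.Icc 1 n, f (t + j * h - h / 2)
    - h / 2 * ∑ j ∈ Finset.Icc 1 (2 * n), f (t + j * h / 2 - h / 4)

/-- The errors `E⁽ˢ⁾ₙ[f] = T̂⁽ˢ⁾ₙ[f] - I[f]` on `[a, b]`, with `T = b - a` and `s = 0, 1, 2`. -/
def quadError (a b t : ℝ) (f : ℝ → ℂ) (s : Fin 3) (n : ℕ) : ℂ :=
  ![quad0 (b - a) t f n, quad1 (b - a) t f n, quad2 (b - a) t f n] s - finitePart f a b t

/-- The formula for the subtracted function `F₁(z)`. It is taken literally, so it is meaningful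
where `sin (π (z - t) / T)` and `cos (π (z - t) / T)` do not vanish, in particular at every
non-real `z`; the remaining (real) points are removable singularities. -/
def F1 (T t : ℝ) (u : ℂ → ℂ) (z : ℂ) : ℂ :=
  kernel T t z *
    (u z - u t - T / Real.pi * deriv u t * Complex.tan (Real.pi * (z - t) / T)
      - (T : ℂ) ^ 2 / (2 * (Real.pi : ℂ) ^ 2) * iteratedDeriv 2 u t
        * Complex.sin (Real.pi * (z - t) / T) ^ 2)

/-- The maximum (supremum) of `|F|` on the line `Im z = y`. -/
def lineMax (F : ℂ → ℂ) (y : ℝ) : ℝ := ⨆ x : ℝ, ‖F (x + y * Complex.I)‖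

/-- `M(τ) = max |F(x + iτ)| + max |F(x - iτ)|`. -/
def M (F : ℂ → ℂ) (τ : ℝ) : ℝ := lineMax F τ + lineMax F (-τ)

/-- `φₙ(τ) = exp (-2nπτ/T) / (1 - exp (-2nπτ/T))`. -/
def phi (T : ℝ) (n : ℕ) (τ : ℝ) : ℝ :=
  Real.exp (-2 * n * Real.pi * τ / T) / (1 - Real.exp (-2 * n * Real.pi * τ / T))

end Supersingular

end

open Supersingular

/-! Write θ = π(z - t)/T. Multiplying out the bracket gives F₁ = K u - S, where S = u(t) K + (T/π)
u'(t) / sin² θ + (T²/2π²) u''(t) cot θ carries the whole singularity of K u (`singularPart`); G =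
`subtracted` is F₁ with its singularities removed. Two facts about S reduce everything to the
trapezoidal rule for G.

The finite part of ∫ S is zero: S has a T-periodic primitive, so the endpoints a and b cancel, and
the jump across t is a multiple of cot(πε/T) = T/(πε) + o(1), which leaves no constant. Hence I[f] =
∫ G (`hasFinitePart_integrand`).

The sums of S over the nodes are explicit: K and cot are odd and cancel by reflection, while the
sums of 1/sin² are (n² - 1)/3 over the interior nodes and n² over the midpoints
(`sum_inv_sin_sq_interior`, `sum_inv_sin_sq_add`). The derivative terms of the formulas remove
exactly these sums and, for s = 0, supply the missing value G(t). So the formulas for s = 0, 1 are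
trapezoidal sums of G (`quad0_eq`, `quad1_eq`), and the third is twice the second at n minus the
second at 2n (`quad2_eq`).

The trapezoidal error for a periodic analytic function is at most T M(τ) φₙ(τ), by moving the
Fourier integrals to the lines Im z = ±τ (`norm_trapezoid_sub_integral_le`). This gives φₙ for s =
0, 1 and 2φₙ + φ₂ₙ for s = 2, at least as sharp as the bounds claimed. -/

/-! ### Taylor expansions and derivatives at a point. -/

/-- Taylor expansion of an analytic function with an analytic remainder factor. -/
theorem AnalyticAt.exists_taylor {f : ℂ → ℂ} {c : ℂ} (hf : AnalyticAt ℂ f c) (n : ℕ) :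
    ∃ r : ℂ → ℂ, AnalyticAt ℂ r c ∧ r c = iteratedDeriv n f c / n.factorial ∧
      ∀ z, f z = ∑ i ∈ Finset.range n, iteratedDeriv i f c / i.factorial * (z - c) ^ i
        + (z - c) ^ n * r z := by
  have hp := hf.hasFPowerSeriesAt
  -- Each divided difference `dslope` shifts the power series by one place, so the value at c of the
  -- k-th iterate is the k-th Taylor coefficient.
  have hval : ∀ k, ((Function.swap dslope c)^[k] f) c = iteratedDeriv k f c / k.factorial := by
    intro k
    have h := hp.has_fpower_series_iterate_dslope_fslope k
    have h2 := h.coeff_zero (fun _ => 1)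
    have h3 := FormalMultilinearSeries.coeff_iterate_fslope
      (p := FormalMultilinearSeries.ofScalars ℂ fun n => iteratedDeriv n f c / n.factorial) k 0
    rw [FormalMultilinearSeries.coeff_ofScalars, zero_add] at h3
    rw [← h2, ← h3]
    rfl
  refine ⟨(Function.swap dslope c)^[n] f,
    (hp.has_fpower_series_iterate_dslope_fslope n).analyticAt, hval n, ?_⟩
  intro z
  induction n with
  | zero => simp
  | succ k ih =>
    rw [ih, Finset.sum_range_succ, Function.iterate_succ_apply', ← hval k]
    have := sub_smul_dslope ((Function.swap dslope c)^[k] f) c z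
    rw [smul_eq_mul] at this
    change _ = _ + _ + (z - c) ^ (k + 1) * dslope ((Function.swap dslope c)^[k] f) c z
    linear_combination (-(z - c) ^ k) * this

/-- In Leibniz' formula the linear factor vanishes at t and has no derivative beyond the first, so
one term survives. Applied repeatedly, this strips a Taylor expansion in Horner form. -/
theorem iteratedDeriv_succ_const_add_mul {S : ℝ → ℂ} {t : ℝ} (hS : AnalyticAt ℝ S t) (c : ℂ)
    (k : ℕ) :
    iteratedDeriv (k + 1) (fun x : ℝ => c + ((x : ℂ) - t) * S x) t
      = (k + 1) * iteratedDeriv k S t := by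
  set v : ℝ → ℂ := fun x => (x : ℂ) - t with hvdef
  have hd : deriv v = fun _ => 1 :=
    funext fun x => ((Complex.ofRealCLM.hasDerivAt (x := x)).sub_const (t : ℂ)).deriv
  have hvc : ContDiff ℝ ω v := Complex.ofRealCLM.contDiff.sub contDiff_const
  have h2 : ∀ i, iteratedDeriv (i + 2) v t = 0 := by
    intro i
    rw [iteratedDeriv_succ', hd, iteratedDeriv_succ']
    simp
  rw [iteratedDeriv_const_add (Nat.succ_pos k)]
  have := iteratedDeriv_mul (n := k + 1) (hvc.contDiffAt.of_le le_top)
    (hS.contDiffAt (n := (k + 1 : ℕ)))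
  rw [show (fun x : ℝ => ((x : ℂ) - t) * S x) = v * S from rfl, this, Finset.sum_range_succ',
    Finset.sum_range_succ', Finset.sum_eq_zero]
  · have h1 : deriv v t = 1 := by rw [hd]
    have h0 : v t = 0 := sub_self _
    simp [h1, h0]
  · intro i _
    rw [add_assoc, h2]
    simp

/-- The first and third derivatives of a function from its expansion to third order. -/
theorem derivs_of_expansion {g R : ℝ → ℂ} {t : ℝ} {a₀ a₁ a₂ : ℂ} (hR : AnalyticAt ℝ R t)
    (hg : g =ᶠ[𝓝 t] fun x : ℝ => a₀ + a₁ * ((x : ℂ) - t) + a₂ * ((x : ℂ) - t) ^ 2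
      + ((x : ℂ) - t) ^ 3 * R x) :
    deriv g t = a₁ ∧ iteratedDeriv 3 g t = 6 * R t := by
  have hv : AnalyticAt ℝ (fun x : ℝ => (x : ℂ) - t) t :=
    (Complex.ofRealCLM.analyticAt t).sub analyticAt_const
  have hg' : g =ᶠ[𝓝 t] fun x : ℝ => a₀ + ((x : ℂ) - t) *
      (a₁ + ((x : ℂ) - t) * (a₂ + ((x : ℂ) - t) * R x)) := by
    filter_upwards [hg] with x hx
    rw [hx]
    ring
  have h2 : AnalyticAt ℝ (fun x : ℝ => a₂ + ((x : ℂ) - t) * R x) t :=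
    analyticAt_const.add (hv.mul hR)
  have h1 : AnalyticAt ℝ (fun x : ℝ => a₁ + ((x : ℂ) - t) * (a₂ + ((x : ℂ) - t) * R x)) t :=
    analyticAt_const.add (hv.mul h2)
  constructor
  · rw [← iteratedDeriv_one, hg'.iteratedDeriv_eq 1,
      iteratedDeriv_succ_const_add_mul h1 a₀ 0]
    simp
  · rw [hg'.iteratedDeriv_eq 3, iteratedDeriv_succ_const_add_mul h1 a₀ 2,
      iteratedDeriv_succ_const_add_mul h2 a₁ 1, iteratedDeriv_succ_const_add_mul hR a₂ 0]
    simp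
    ring

/-! ### The trapezoidal rule for periodic analytic functions. -/

theorem isOpen_strip (σ : ℝ) : IsOpen (strip σ) :=
  isOpen_lt (continuous_abs.comp Complex.continuous_im) continuous_const

theorem continuous_line {σ : ℝ} {H : ℂ → ℂ} (hH : DifferentiableOn ℂ H (strip σ)) {y : ℝ}
    (hy : |y| < σ) : Continuous fun x : ℝ => H (x + y * Complex.I) := by
  refine hH.continuousOn.comp_continuous (by fun_prop) fun x => ?_
  simpa [strip] using hy

/-- The mean of a periodic analytic function over a period does not depend on the height. -/
theorem integral_line_eq {σ P : ℝ} {H : ℂ → ℂ} (hH : DifferentiableOn ℂ H (strip σ))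
    (hper : ∀ z ∈ strip σ, H (z + P) = H z) {y : ℝ} (hy : |y| < σ) (a : ℝ) :
    ∫ x in a..a + P, H (x + y * Complex.I) = ∫ x in a..a + P, H x := by
  have hmem : ∀ s ∈ uIcc 0 y, |s| < σ := by
    intro s hs
    refine lt_of_le_of_lt ?_ hy
    have := abs_sub_left_of_mem_uIcc hs
    simpa using this
  have key := Complex.integral_boundary_rect_eq_zero_of_differentiableOn H (a : ℂ)
    ((a + P : ℝ) + y * Complex.I) (hH.mono ?_)
  · simp only [Complex.ofReal_re, Complex.ofReal_im, Complex.add_re, Complex.mul_re, Complex.I_re,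
      mul_zero, Complex.I_im, mul_one, sub_self, add_zero, Complex.add_im, Complex.mul_im,
      zero_add, Complex.ofReal_zero, zero_mul] at key
    -- The two vertical sides of Cauchy's rectangle cancel by periodicity.
    have h2 : ∫ s in (0 : ℝ)..y, H (((a + P : ℝ) : ℂ) + s * Complex.I)
        = ∫ s in (0 : ℝ)..y, H ((a : ℂ) + s * Complex.I) := by
      refine intervalIntegral.integral_congr fun s hs => ?_
      have := hper (a + s * Complex.I) (by simpa [strip] using hmem s hs)
      rw [← this]
      congr 1
      push_cast
      ring
    rw [h2] at key
    linear_combination -key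
  · intro z hz
    have := hz.2
    simp only [mem_preimage] at this
    exact hmem _ (by simpa using this)

/-- The error of the one-point rule for a periodic analytic function. -/
theorem norm_period_mul_sub_integral_le {σ P τ A B : ℝ} (hP : 0 < P) {H : ℂ → ℂ}
    (hH : DifferentiableOn ℂ H (strip σ)) (hper : ∀ z ∈ strip σ, H (z + P) = H z)
    (hτ : τ ∈ Ioo 0 σ) (hA : ∀ x : ℝ, ‖H (x + τ * Complex.I)‖ ≤ A)
    (hB : ∀ x : ℝ, ‖H (x + (-τ : ℝ) * Complex.I)‖ ≤ B) (x a : ℝ) :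
    ‖P * H x - ∫ y in a..a + P, H y‖ ≤ P * (A + B) * phi P 1 τ := by
  have : Fact (0 < P) := ⟨hP⟩
  have hσ : 0 < σ := hτ.1.trans hτ.2
  set q := Real.exp (-2 * Real.pi * τ / P) with hq
  have hq0 : 0 < q := Real.exp_pos _
  have hq1 : q < 1 := by
    rw [hq, Real.exp_lt_one_iff]
    have := Real.pi_pos
    have := hτ.1
    have : 0 < 2 * Real.pi * τ / P := by positivity
    have e : -2 * Real.pi * τ / P = -(2 * Real.pi * τ / P) := by ring
    linarith
  have hreal : ∀ r : ℝ, (r : ℂ) ∈ strip σ := fun r => by simpa [strip] using hσ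
  have hp : Function.Periodic (fun r : ℝ => H r) P := fun r => by
    simpa using hper r (hreal r)
  have hcont : Continuous fun r : ℝ => H r := by
    have := continuous_line hH (y := 0) (by simpa using hσ)
    simpa using this
  let F : C(AddCircle P, ℂ) := ⟨hp.lift, continuous_coinduced_dom.mpr hcont⟩
  have hF : ∀ r : ℝ, F (r : AddCircle P) = H r := fun r => hp.lift_coe r
  -- shifted formula for the coefficients
  have hcoef : ∀ (m : ℤ) (y : ℝ), |y| < σ → fourierCoeff F m = (1 / P : ℝ) •
      ∫ r in a..a + P, Complex.exp (-2 * Real.pi * Complex.I * m * (r + y * Complex.I) / P)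
        * H (r + y * Complex.I) := by
    intro m y hy
    have hd : DifferentiableOn ℂ (fun z => Complex.exp (-2 * Real.pi * Complex.I * m * z / P)
        * H z) (strip σ) := by
      refine DifferentiableOn.mul ?_ hH
      exact Differentiable.differentiableOn (by fun_prop)
    rw [fourierCoeff_eq_intervalIntegral F m a,
      integral_line_eq (P := P) hd ?_ hy a]
    · congr 1
      refine intervalIntegral.integral_congr fun r _ => ?_
      simp only [fourier_coe_apply, hF, smul_eq_mul]
      congr 2
      push_cast
      ring
    · intro z hz
      simp only [hper z hz]
      congr 1
      rw [Complex.exp_eq_exp_iff_exists_int]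
      refine ⟨-m, ?_⟩
      have : (P : ℂ) ≠ 0 := by exact_mod_cast hP.ne'
      field_simp
      push_cast
      ring
  have hbd : ∀ (m : ℤ) (y C : ℝ), |y| < σ → (∀ r : ℝ, ‖H (r + y * Complex.I)‖ ≤ C) →
      ‖fourierCoeff F m‖ ≤ C * Real.exp (2 * Real.pi * m * y / P) := by
    intro m y C hy hC
    rw [hcoef m y hy, norm_smul]
    have := intervalIntegral.norm_integral_le_of_norm_le_const (a := a) (b := a + P)
      (C := C * Real.exp (2 * Real.pi * m * y / P)) (f := fun r : ℝ =>
        Complex.exp (-2 * Real.pi * Complex.I * m * (r + y * Complex.I) / P)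
        * H (r + y * Complex.I)) ?_
    · rw [add_sub_cancel_left, abs_of_pos hP] at this
      calc _ ≤ ‖(1 / P : ℝ)‖ * (C * Real.exp (2 * Real.pi * m * y / P) * P) := by gcongr
        _ = _ := by
          rw [Real.norm_of_nonneg (by positivity)]
          field_simp
    · intro r _
      rw [norm_mul, Complex.norm_exp, mul_comm]
      have : (-2 * Real.pi * Complex.I * m * (r + y * Complex.I) / P : ℂ).re
          = 2 * Real.pi * m * y / P := by
        have e : (-2 * Real.pi * Complex.I * m * (r + y * Complex.I) / P : ℂ)
          = ((2 * Real.pi * m * y / P : ℝ) : ℂ)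
            + ((-2 * Real.pi * m * r / P : ℝ) : ℂ) * Complex.I := by
          push_cast
          linear_combination (-2 * Real.pi * m * y / P : ℂ) * Complex.I_sq
        rw [e]
        simp
      rw [this]
      gcongr
      exact hC r
  have hτσ : |τ| < σ := by rw [abs_of_pos hτ.1]; exact hτ.2
  have hpow : ∀ n : ℕ, q ^ n = Real.exp (-2 * Real.pi * n * τ / P) := by
    intro n
    rw [hq, ← Real.exp_nat_mul]
    congr 1
    ring
  -- On Im z = y the m-th exponential has modulus exp(2πmy/P): positive frequencies decay on the
  -- lower line and negative ones on the upper line.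
  have hpos : ∀ n : ℕ, ‖fourierCoeff F n‖ ≤ B * q ^ n := by
    intro n
    refine (hbd n (-τ) B (by rwa [abs_neg]) hB).trans_eq ?_
    rw [hpow]
    push_cast
    congr 2
    ring
  have hneg : ∀ n : ℕ, ‖fourierCoeff F (-(n + 1 : ℤ))‖ ≤ A * q ^ (n + 1) := by
    intro n
    refine (hbd _ τ A hτσ hA).trans_eq ?_
    rw [hpow]
    push_cast
    congr 2
    ring
  -- Majorant of the Fourier series of H minus its mean, hence zero at m = 0. The two geometric
  -- tails sum to (A + B) q / (1 - q).
  let β : ℤ → ℝ := fun m => if m = 0 then 0 else if 0 < m then B * q ^ m.toNat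
    else A * q ^ (-m).toNat
  have hgeo := (hasSum_geometric_of_lt_one hq0.le hq1)
  have hβ : HasSum β ((A + B) * (q / (1 - q))) := by
    have e1 : HasSum (fun n : ℕ => β n) (B * q * (1 - q)⁻¹) := by
      have h := (hasSum_nat_add_iff (f := fun n : ℕ => β n) 1).mp
        ((hgeo.mul_left (B * q)).congr_fun fun n => ?_)
      · simpa [β] using h
      · have h1 : ((n + 1 : ℕ) : ℤ) ≠ 0 := by omega
        have h2 : 0 < ((n + 1 : ℕ) : ℤ) := by omega
        simp only [β, h1, h2, if_false, if_true, Int.toNat_natCast]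
        ring
    have e2 : HasSum (fun n : ℕ => β (-((n : ℤ) + 1))) (A * q * (1 - q)⁻¹) := by
      refine (hgeo.mul_left (A * q)).congr_fun fun n => ?_
      have h1 : -((n : ℤ) + 1) ≠ 0 := by omega
      have h2 : ¬ 0 < -((n : ℤ) + 1) := by omega
      have e : (-(-(n + 1 : ℤ))).toNat = n + 1 := by omega
      simp only [β, h1, h2, if_false, e]
      ring
    have := HasSum.of_nat_of_neg_add_one e1 e2
    convert this using 1
    ring
  have hle : ∀ m : ℤ, m ≠ 0 → ‖fourierCoeff F m‖ ≤ β m := by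
    intro m hm
    rcases lt_or_gt_of_ne hm with h | h
    · obtain ⟨n, rfl⟩ : ∃ n : ℕ, m = -(n + 1 : ℤ) := ⟨(-m - 1).toNat, by omega⟩
      have e : (-(-(n + 1 : ℤ))).toNat = n + 1 := by omega
      simp only [β, hm, if_false, h.not_gt, e]
      exact hneg n
    · obtain ⟨n, rfl⟩ : ∃ n : ℕ, m = n := ⟨m.toNat, by omega⟩
      simp only [β, hm, if_false, h, if_true, Int.toNat_natCast]
      exact hpos n
  have hsum : Summable (fourierCoeff F) := by
    refine Summable.of_norm_bounded_eventually (g := β) hβ.summable ?_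
    filter_upwards [(Set.finite_singleton (0 : ℤ)).compl_mem_cofinite] with m hm
    exact hle m hm
  have hs := has_pointwise_sum_fourier_series_of_summable hsum (x : AddCircle P)
  have h0 : HasSum (fun i : ℤ => if i = 0 then fourierCoeff F 0 else 0) (fourierCoeff F 0) :=
    hasSum_ite_eq 0 _
  have hd := hs.sub h0
  have hfin := hd.norm_le_of_bounded hβ (by
    intro m
    by_cases hm : m = 0
    · subst hm
      simp [β]
    · simp only [hm, if_false, sub_zero, norm_smul]
      have : ‖fourier m (x : AddCircle P)‖ = 1 := by
        rw [fourier_apply]; exact Circle.norm_coe _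
      rw [this, mul_one]
      exact hle m hm)
  have hc0 : (P : ℂ) * fourierCoeff F 0 = ∫ y in a..a + P, H y := by
    rw [hcoef 0 0 (by simpa using hσ)]
    have : (P : ℂ) ≠ 0 := by exact_mod_cast hP.ne'
    simp
    field_simp
  rw [hF] at hfin
  have e : (P : ℂ) * H x - ∫ y in a..a + P, H y = P * (H x - fourierCoeff F 0) := by
    rw [← hc0]; ring
  rw [e, norm_mul, Complex.norm_real, Real.norm_of_nonneg hP.le, mul_assoc]
  refine mul_le_mul_of_nonneg_left (hfin.trans_eq ?_) hP.le
  simp only [phi, hq]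
  simp

/-- The error of the `n`-point trapezoidal rule for a periodic analytic function. -/
theorem norm_trapezoid_sub_integral_le {σ P τ A B : ℝ} (hP : 0 < P) {G : ℂ → ℂ}
    (hG : DifferentiableOn ℂ G (strip σ)) (hper : ∀ z ∈ strip σ, G (z + P) = G z)
    (hτ : τ ∈ Ioo 0 σ) (hA : ∀ x : ℝ, ‖G (x + τ * Complex.I)‖ ≤ A)
    (hB : ∀ x : ℝ, ‖G (x + (-τ : ℝ) * Complex.I)‖ ≤ B) {n : ℕ} (hn : 1 ≤ n) (x a : ℝ) :
    ‖((P / n : ℝ) : ℂ) * ∑ j ∈ Finset.range n, G ((x + j * (P / n) : ℝ) : ℂ)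
      - ∫ y in a..a + P, G y‖ ≤ P * (A + B) * phi P n τ := by
  have hn0 : (0 : ℝ) < n := by exact_mod_cast hn
  have hσ : 0 < σ := hτ.1.trans hτ.2
  set h : ℝ := P / n with hh
  have hnh : (n : ℝ) * h = P := by rw [hh]; field_simp
  have hh0 : 0 < h := by positivity
  have hmem : ∀ z ∈ strip σ, ∀ r : ℝ, z + r ∈ strip σ := fun z hz r => by
    simpa [strip] using hz
  -- The sum over all nodes has period h = P/n, so the n-point rule for G is the one-point rule for
  -- H.
  set H : ℂ → ℂ := fun z => ∑ j ∈ Finset.range n, G (z + ((j * h : ℝ) : ℂ)) with hH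
  have hHd : DifferentiableOn ℂ H (strip σ) := by
    refine DifferentiableOn.fun_sum fun j _ => ?_
    exact hG.comp (by fun_prop) fun z hz => hmem z hz _
  -- A shift by h permutes the nodes cyclically: the new last term equals the old first one by the
  -- P-periodicity of G.
  have hHper : ∀ z ∈ strip σ, H (z + h) = H z := by
    intro z hz
    have e1 := Finset.sum_range_succ (fun j : ℕ => G (z + ((j * h : ℝ) : ℂ))) n
    rw [Finset.sum_range_succ', hnh, hper z hz] at e1
    simp only [Nat.cast_zero, zero_mul, Complex.ofReal_zero, add_zero] at e1
    have e2 := add_right_cancel e1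
    simp only [hH]
    rw [← e2]
    refine Finset.sum_congr rfl fun j _ => ?_
    congr 1
    push_cast
    ring
  have hbound : ∀ (y C : ℝ), (∀ x : ℝ, ‖G (x + y * Complex.I)‖ ≤ C) → ∀ x : ℝ,
      ‖H (x + y * Complex.I)‖ ≤ n * C := by
    intro y C hC x
    refine (norm_sum_le _ _).trans ?_
    refine (Finset.sum_le_card_nsmul _ _ C fun j _ => ?_).trans_eq (by simp)
    have e : (x : ℂ) + y * Complex.I + ((j * h : ℝ) : ℂ) = ((x + j * h : ℝ) : ℂ) + y * Complex.I := by
      push_cast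
      ring
    rw [e]
    exact hC _
  have hcont : Continuous fun r : ℝ => G r := by
    have := continuous_line hG (y := 0) (by simpa using hσ)
    simpa using this
  have hint : ∫ y in a..a + h, H y = ∫ y in a..a + P, G y := by
    have hadj := intervalIntegral.sum_integral_adjacent_intervals (μ := volume)
      (f := fun r : ℝ => G r) (a := fun j : ℕ => a + j * h) (n := n)
      fun k _ => hcont.intervalIntegrable _ _
    simp only [Nat.cast_zero, zero_mul, add_zero, hnh] at hadj
    rw [← hadj]
    simp only [hH]
    rw [intervalIntegral.integral_finsetSum]
    · refine Finset.sum_congr rfl fun j _ => ?_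
      have := intervalIntegral.integral_comp_add_right (a := a) (b := a + h)
        (fun r : ℝ => G r) (j * h)
      rw [show a + ((j + 1 : ℕ) : ℝ) * h = a + h + j * h by push_cast; ring, ← this]
      simp only [Complex.ofReal_add]
    · intro j _
      refine Continuous.intervalIntegrable ?_ _ _
      have := hcont.comp (continuous_add_const ((j : ℝ) * h))
      simpa [Function.comp_def] using this
  have key := norm_period_mul_sub_integral_le hh0 hHd hHper hτ (hbound _ _ hA) (hbound _ _ hB) x a
  rw [hint] at key
  have hphi : phi h 1 τ = phi P n τ := by
    have : -2 * ((1 : ℕ) : ℝ) * Real.pi * τ / h = -2 * n * Real.pi * τ / P := by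
      rw [hh]
      push_cast
      field_simp
    simp only [phi, this]
  rw [hphi] at key
  have e : h * (n * A + n * B) * phi P n τ = P * (A + B) * phi P n τ := by
    rw [← hnh]; ring
  rw [e] at key
  simpa only [hH, Complex.ofReal_add] using key

/-! ### Expansions of sine and cosine, and finite trigonometric sums. -/

/-- The remainder factor vanishes at 0 because the next Taylor coefficient does; the same holds for
the cosine. These zeros later show that K has no constant term at t. -/
theorem exists_sin_expansion : ∃ p : ℂ → ℂ, AnalyticAt ℂ p 0 ∧ p 0 = 0 ∧
    ∀ z, Complex.sin z = z - z ^ 3 / 6 + z ^ 4 * p z := by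
  obtain ⟨p, hp, hp0, h⟩ := (Complex.analyticAt_sin (x := 0)).exists_taylor 4
  refine ⟨p, hp, ?_, fun z => ?_⟩
  · rw [hp0]
    simp [iteratedDeriv_succ']
  · rw [h z]
    simp [Finset.sum_range_succ, iteratedDeriv_succ', Nat.factorial]
    ring

theorem exists_cos_expansion : ∃ q : ℂ → ℂ, AnalyticAt ℂ q 0 ∧ q 0 = 0 ∧
    ∀ z, Complex.cos z = 1 - z ^ 2 / 2 + z ^ 3 * q z := by
  obtain ⟨q, hq, hq0, h⟩ := (Complex.analyticAt_cos (x := 0)).exists_taylor 3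
  refine ⟨q, hq, ?_, fun z => ?_⟩
  · rw [hq0]
    simp [iteratedDeriv_succ']
  · rw [h z]
    simp [Finset.sum_range_succ, iteratedDeriv_succ', Nat.factorial]
    ring

/-- Origin of the constant 1/3 in the sum over the interior nodes. -/
theorem tendsto_inv_sin_sq_sub_inv_sq :
    Tendsto (fun z : ℂ => 1 / Complex.sin z ^ 2 - 1 / z ^ 2) (𝓝[≠] 0) (𝓝 (1 / 3)) := by
  obtain ⟨p, hp, hp0, h⟩ := exists_sin_expansion
  set s : ℂ → ℂ := fun z => 1 / 6 - z * p z with hs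
  have hsc : ContinuousAt s 0 := continuousAt_const.sub (continuousAt_id.mul hp.continuousAt)
  have hden : ContinuousAt (fun z => (1 - z ^ 2 * s z) ^ 2) 0 :=
    (continuousAt_const.sub ((continuousAt_id.pow 2).mul hsc)).pow 2
  have hlim : ContinuousAt (fun z => (2 * s z - z ^ 2 * s z ^ 2) / (1 - z ^ 2 * s z) ^ 2) 0 :=
    ((continuousAt_const.mul hsc).sub ((continuousAt_id.pow 2).mul (hsc.pow 2))).div hden
      (by simp)
  have h3 := hlim.tendsto.mono_left (nhdsWithin_le_nhds (s := {0}ᶜ))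
  have e : (2 * s 0 - 0 ^ 2 * s 0 ^ 2) / (1 - 0 ^ 2 * s 0) ^ 2 = 1 / 3 := by
    simp [hs]; norm_num
  rw [e] at h3
  refine h3.congr' ?_
  have hne : ∀ᶠ z in 𝓝[≠] (0 : ℂ), (1 - z ^ 2 * s z) ^ 2 ≠ 0 :=
    (hden.eventually_ne (by simp)).filter_mono nhdsWithin_le_nhds
  filter_upwards [hne, self_mem_nhdsWithin] with z hz hz0
  have hz0 : z ≠ 0 := hz0
  have hz' : 1 - z ^ 2 * s z ≠ 0 := fun h => hz (by rw [h]; simp)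
  have hsin : Complex.sin z = z * (1 - z ^ 2 * s z) := by rw [h z, hs]; ring
  rw [hsin, div_sub_div _ _ (pow_ne_zero 2 (mul_ne_zero hz0 hz')) (pow_ne_zero 2 hz0),
    div_eq_div_iff hz (mul_ne_zero (pow_ne_zero 2 (mul_ne_zero hz0 hz')) (pow_ne_zero 2 hz0))]
  ring

theorem sin_add_ne_zero {n : ℕ} (hn : 1 ≤ n) {z : ℂ} (hz : Complex.sin (n * z) ≠ 0) (j : ℕ) :
    Complex.sin (z + Real.pi * j / n) ≠ 0 := by
  intro h
  obtain ⟨k, hk⟩ := Complex.sin_eq_zero_iff.mp h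
  apply hz
  rw [Complex.sin_eq_zero_iff]
  refine ⟨n * k - j, ?_⟩
  have hn0 : (n : ℂ) ≠ 0 := by exact_mod_cast (by omega : n ≠ 0)
  rw [eq_sub_of_add_eq hk]
  push_cast
  field_simp

/-- With w = exp(2iz) ζʲ, ζ a primitive n-th root of unity, cot is i(1 - 2/(1 - w)), and 1/(1 - w)
is the geometric sum of wᵐ for m < n divided by 1 - wⁿ, where wⁿ does not depend on j. Summing over
j kills every power except m = 0. -/
theorem sum_cot_add {n : ℕ} (hn : 1 ≤ n) {z : ℂ} (hz : Complex.sin (n * z) ≠ 0) :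
    ∑ j ∈ Finset.range n, Complex.cot (z + Real.pi * j / n) = n * Complex.cot (n * z) := by
  have hn0 : (n : ℂ) ≠ 0 := by exact_mod_cast (by omega : n ≠ 0)
  set ζ := Complex.exp (2 * Real.pi * Complex.I / n) with hζ
  set W := Complex.exp (2 * Complex.I * z) with hW
  have hprim : IsPrimitiveRoot ζ n := Complex.isPrimitiveRoot_exp n (by omega)
  have hWn : Complex.exp (2 * Complex.I * (n * z)) = W ^ n := by
    rw [hW, ← Complex.exp_nat_mul]
    congr 1
    ring
  have hwj : ∀ j : ℕ, Complex.exp (2 * Complex.I * (z + Real.pi * j / n)) = W * ζ ^ j := by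
    intro j
    rw [hW, hζ, ← Complex.exp_nat_mul, ← Complex.exp_add]
    congr 1
    ring
  have hne : 1 - W ^ n ≠ 0 := by
    rw [← hWn]
    intro h
    have h1 : Complex.exp (2 * Complex.I * (n * z)) = 1 := (sub_eq_zero.mp h).symm
    obtain ⟨k, hk⟩ := Complex.exp_eq_one_iff.mp h1
    refine hz (Complex.sin_eq_zero_iff.mpr ⟨k, ?_⟩)
    have := Complex.I_ne_zero
    have h2 : (2 * Complex.I) * (n * z) = (2 * Complex.I) * (k * Real.pi) := by rw [hk]; ring
    exact mul_left_cancel₀ (by simp) h2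
  have hgeom : ∀ j : ℕ, (1 - W * ζ ^ j) * ∑ m ∈ Finset.range n, (W * ζ ^ j) ^ m = 1 - W ^ n := by
    intro j
    rw [mul_neg_geom_sum, mul_pow, ← pow_mul, mul_comm j n, pow_mul, hprim.pow_eq_one, one_pow,
      mul_one]
  have hne' : ∀ j : ℕ, 1 - W * ζ ^ j ≠ 0 := fun j h => hne (by rw [← hgeom j, h, zero_mul])
  have hcot : ∀ j : ℕ, Complex.cot (z + Real.pi * j / n)
      = Complex.I * (1 - 2 / (1 - W ^ n) * ∑ m ∈ Finset.range n, (W * ζ ^ j) ^ m) := by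
    intro j
    have h1 : ∑ m ∈ Finset.range n, (W * ζ ^ j) ^ m = (1 - W ^ n) / (1 - W * ζ ^ j) := by
      rw [← hgeom j, mul_div_cancel_left₀ _ (hne' j)]
    rw [Complex.cot_eq_exp_ratio, hwj, h1]
    have := hne' j
    field_simp
    linear_combination (W * ζ ^ j + 1) * Complex.I_sq
  have hsum : ∑ j ∈ Finset.range n, ∑ m ∈ Finset.range n, (W * ζ ^ j) ^ m = n := by
    rw [Finset.sum_comm, Finset.sum_eq_single 0]
    · simp
    · intro m hm hm0
      have h1 : ζ ^ m ≠ 1 := hprim.pow_ne_one_of_pos_of_lt hm0 (Finset.mem_range.mp hm)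
      have h2 : (ζ ^ m - 1) * ∑ j ∈ Finset.range n, (ζ ^ m) ^ j = 0 := by
        rw [mul_geom_sum, ← pow_mul, mul_comm m n, pow_mul, hprim.pow_eq_one, one_pow, sub_self]
      have h3 := (mul_eq_zero.mp h2).resolve_left (sub_ne_zero.mpr h1)
      have h4 : ∀ j : ℕ, (W * ζ ^ j) ^ m = W ^ m * (ζ ^ m) ^ j := fun j => by
        rw [mul_pow, ← pow_mul, ← pow_mul, mul_comm j m]
      simp only [h4]
      rw [← Finset.mul_sum, h3, mul_zero]
    · intro h
      exact absurd (Finset.mem_range.mpr (by omega)) h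
  simp only [hcot]
  rw [← Finset.mul_sum, Finset.sum_sub_distrib, ← Finset.mul_sum, hsum, Complex.cot_eq_exp_ratio,
    hWn]
  simp only [Finset.sum_const, Finset.card_range, nsmul_eq_mul, mul_one]
  field_simp
  linear_combination (-W ^ n - 1) * Complex.I_sq

theorem hasDerivAt_cot {z : ℂ} (hz : Complex.sin z ≠ 0) :
    HasDerivAt Complex.cot (-(1 / Complex.sin z ^ 2)) z := by
  have h := (Complex.hasDerivAt_cos z).div (Complex.hasDerivAt_sin z) hz
  refine (h.congr_of_eventuallyEq (Eventually.of_forall fun w => rfl)).congr_deriv ?_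
  have := Complex.sin_sq_add_cos_sq z
  field_simp
  linear_combination -this

/-- Obtained by differentiating the cotangent identity, which holds on a neighbourhood of z. -/
theorem sum_inv_sin_sq_add {n : ℕ} (hn : 1 ≤ n) {z : ℂ} (hz : Complex.sin (n * z) ≠ 0) :
    ∑ j ∈ Finset.range n, 1 / Complex.sin (z + Real.pi * j / n) ^ 2
      = n ^ 2 / Complex.sin (n * z) ^ 2 := by
  have h1 : HasDerivAt (fun w : ℂ => ∑ j ∈ Finset.range n, Complex.cot (w + Real.pi * j / n))
      (∑ j ∈ Finset.range n, -(1 / Complex.sin (z + Real.pi * j / n) ^ 2)) z :=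
    HasDerivAt.fun_sum fun j _ => (hasDerivAt_cot (sin_add_ne_zero hn hz j)).comp_add_const z _
  have h2 : HasDerivAt (fun w : ℂ => n * Complex.cot (n * w))
      (n * (-(1 / Complex.sin (n * z) ^ 2) * n)) z :=
    ((hasDerivAt_cot hz).comp z (by simpa using (hasDerivAt_id z).const_mul (n : ℂ))).const_mul _
  have hev : (fun w : ℂ => ∑ j ∈ Finset.range n, Complex.cot (w + Real.pi * j / n))
      =ᶠ[𝓝 z] fun w : ℂ => n * Complex.cot (n * w) := by
    have hc : ContinuousAt (fun w : ℂ => Complex.sin (n * w)) z := by fun_prop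
    filter_upwards [hc.eventually_ne hz] with w hw
    exact sum_cot_add hn hw
  have := h1.unique (h2.congr_of_eventuallyEq hev)
  rw [Finset.sum_neg_distrib] at this
  linear_combination -this

theorem sin_interior_ne_zero {n j : ℕ} (hj : j ∈ Finset.Ico 1 n) :
    Complex.sin (Real.pi * j / n) ≠ 0 := by
  intro h
  rw [Finset.mem_Ico] at hj
  have hn' : (0 : ℝ) < n := by exact_mod_cast (by omega : 0 < n)
  have hj' : (0 : ℝ) < j := by exact_mod_cast hj.1
  have hjn : (j : ℝ) < n := by exact_mod_cast hj.2
  have h2 : Real.sin (Real.pi * j / n) = 0 := by exact_mod_cast h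
  have hpi := Real.pi_pos
  refine (Real.sin_pos_of_pos_of_lt_pi (by positivity) ?_).ne' h2
  rw [div_lt_iff₀ hn']
  gcongr

/-- Move the term j = 0 of the full sum to the other side and let z → 0. The poles n²/(nz)² and 1/z²
cancel, and the constants 1/3 leave (n² - 1)/3. -/
theorem sum_inv_sin_sq_interior {n : ℕ} (hn : 1 ≤ n) :
    ∑ j ∈ Finset.Ico 1 n, 1 / Complex.sin (Real.pi * j / n) ^ 2 = ((n : ℂ) ^ 2 - 1) / 3 := by
  have hn0 : (n : ℂ) ≠ 0 := by exact_mod_cast (by omega : n ≠ 0)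
  have hsin : ∀ j ∈ Finset.Ico 1 n, Complex.sin (Real.pi * j / n) ≠ 0 := fun j hj =>
    sin_interior_ne_zero hj
  have hL : Tendsto (fun z : ℂ => ∑ j ∈ Finset.Ico 1 n, 1 / Complex.sin (z + Real.pi * j / n) ^ 2)
      (𝓝[≠] 0) (𝓝 (∑ j ∈ Finset.Ico 1 n, 1 / Complex.sin (Real.pi * j / n) ^ 2)) := by
    refine Tendsto.mono_left ?_ nhdsWithin_le_nhds
    refine tendsto_finsetSum _ fun j hj => ?_
    have : ContinuousAt (fun z : ℂ => 1 / Complex.sin (z + Real.pi * j / n) ^ 2) 0 := by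
      refine continuousAt_const.div (by fun_prop) ?_
      simpa using hsin j hj
    simpa using this.tendsto
  have hscale : Tendsto (fun z : ℂ => (n : ℂ) * z) (𝓝[≠] 0) (𝓝[≠] 0) := by
    refine tendsto_nhdsWithin_iff.mpr ⟨?_, ?_⟩
    · have : ContinuousAt (fun z : ℂ => (n : ℂ) * z) 0 := by fun_prop
      simpa using this.tendsto.mono_left (nhdsWithin_le_nhds (s := {0}ᶜ))
    · filter_upwards [self_mem_nhdsWithin] with z hz
      exact mul_ne_zero hn0 hz
  have hR := ((tendsto_inv_sin_sq_sub_inv_sq.comp hscale).const_mul ((n : ℂ) ^ 2)).sub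
    tendsto_inv_sin_sq_sub_inv_sq
  have hne : ∀ᶠ z in 𝓝[≠] (0 : ℂ), Complex.sin z ≠ 0 := by
    obtain ⟨p, hp, hp0, h⟩ := exists_sin_expansion
    have hc : ContinuousAt (fun z => 1 - z ^ 2 / 6 + z ^ 3 * p z) 0 :=
      (by fun_prop : ContinuousAt (fun z : ℂ => 1 - z ^ 2 / 6) 0).add
        ((continuousAt_id.pow 3).mul hp.continuousAt)
    filter_upwards [(hc.eventually_ne (y := 0) (by simp)).filter_mono nhdsWithin_le_nhds,
      self_mem_nhdsWithin] with z hz hz0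
    have : Complex.sin z = z * (1 - z ^ 2 / 6 + z ^ 3 * p z) := by rw [h z]; ring
    rw [this]
    exact mul_ne_zero hz0 hz
  have heq := hL.congr' (f₂ := fun z : ℂ => (n : ℂ) ^ 2 * (1 / Complex.sin (n * z) ^ 2
      - 1 / (n * z) ^ 2) - (1 / Complex.sin z ^ 2 - 1 / z ^ 2)) (by
    filter_upwards [hscale.eventually hne, self_mem_nhdsWithin] with z hz hz0
    have hz0 : z ≠ 0 := hz0
    have h := sum_inv_sin_sq_add hn hz
    rw [Finset.range_eq_Ico, Finset.sum_eq_sum_Ico_succ_bot (by omega)] at h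
    simp only [Nat.cast_zero, mul_zero, zero_div, add_zero, zero_add] at h
    rw [eq_sub_of_add_eq' h]
    field_simp
    ring)
  rw [tendsto_nhds_unique heq hR]
  ring

theorem sum_Ico_eq_zero_of_reflect {F : ℕ → ℂ} {n : ℕ}
    (h : ∀ j ∈ Finset.Ico 1 n, F (n - j) = -F j) : ∑ j ∈ Finset.Ico 1 n, F j = 0 := by
  have h1 := Finset.sum_Ico_reflect F 1 (m := n) (n := n) (by omega)
  rw [Finset.sum_congr rfl h, Finset.sum_neg_distrib, Nat.add_sub_cancel_left,
    Nat.add_sub_cancel] at h1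
  linear_combination (-1 / 2) * h1

/-! ### The subtracted function and its analyticity. -/

/-- The part of `K u` that is not integrable at `t`, in terms of `K`, `sin⁻²` and `cot`. -/
noncomputable def singularPart (T t : ℝ) (u : ℂ → ℂ) (z : ℂ) : ℂ :=
  u t * kernel T t z + T / Real.pi * deriv u t / Complex.sin (Real.pi * (z - t) / T) ^ 2
    + (T : ℂ) ^ 2 / (2 * (Real.pi : ℂ) ^ 2) * iteratedDeriv 2 u t
      * (Complex.cos (Real.pi * (z - t) / T) / Complex.sin (Real.pi * (z - t) / T))

open Classical in
/-- The function `F₁` with its removable singularities removed. -/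
noncomputable def subtracted (T t : ℝ) (u : ℂ → ℂ) (z : ℂ) : ℂ :=
  if Complex.sin (Real.pi * (z - t) / T) = 0 then
    ((T : ℂ) / Real.pi) ^ 3 * (iteratedDeriv 3 u t / 6) - T / Real.pi * deriv u t / 3
  else kernel T t z * u z - singularPart T t u z

theorem subtracted_of_ne {T t : ℝ} {u : ℂ → ℂ} {z : ℂ}
    (hs : Complex.sin (Real.pi * (z - t) / T) ≠ 0) :
    subtracted T t u z = kernel T t z * u z - singularPart T t u z := if_neg hs

/-- Since K tan = 1/sin² and K sin² = cot, the poles of the tangent disappear: zeros of the cosine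
are only removable singularities of F₁. -/
theorem subtracted_eq_F1 {T t : ℝ} {u : ℂ → ℂ} {z : ℂ}
    (hs : Complex.sin (Real.pi * (z - t) / T) ≠ 0) (hc : Complex.cos (Real.pi * (z - t) / T) ≠ 0) :
    subtracted T t u z = F1 T t u z := by
  rw [subtracted_of_ne hs, singularPart, F1, kernel, Complex.tan_eq_sin_div_cos]
  generalize Complex.sin (Real.pi * (z - t) / T) = s at *
  generalize Complex.cos (Real.pi * (z - t) / T) = c at *
  generalize (T : ℂ) / Real.pi * deriv u t = A
  generalize (T : ℂ) ^ 2 / (2 * (Real.pi : ℂ) ^ 2) * iteratedDeriv 2 u t = B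
  field_simp
  ring

theorem angle_add {T : ℝ} (hT : 0 < T) (t : ℝ) (z : ℂ) :
    (Real.pi : ℂ) * (z + T - t) / T = Real.pi * (z - t) / T + Real.pi := by
  have : (T : ℂ) ≠ 0 := by exact_mod_cast hT.ne'
  field_simp
  ring

/-- Sine and cosine both change sign under θ → θ + π, which leaves K, 1/sin² and cot unchanged. -/
theorem subtracted_add_period {T t : ℝ} (hT : 0 < T) {u : ℂ → ℂ} {z : ℂ} (hu : u (z + T) = u z) :
    subtracted T t u (z + T) = subtracted T t u z := by
  have h1 : ∀ s c : ℂ, -c / (-s) ^ 3 = c / s ^ 3 := fun s c => by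
    rw [Odd.neg_pow (by decide), neg_div_neg_eq]
  simp only [subtracted, singularPart, kernel, angle_add hT, Complex.sin_add_pi, Complex.cos_add_pi,
    hu, neg_eq_zero, neg_div_neg_eq, neg_sq, h1]

theorem eq_of_add_int_mul {σ T : ℝ} {f : ℂ → ℂ} (hper : ∀ z ∈ strip σ, f (z + T) = f z) {z : ℂ}
    (hz : z ∈ strip σ) (k : ℤ) : f (z + k * T) = f z := by
  have hmem : ∀ k : ℤ, z + k * T ∈ strip σ := fun k => by simpa [strip] using hz
  induction k using Int.induction_on with
  | zero => simp
  | succ i ih =>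
    rw [← ih, ← hper _ (hmem i)]
    congr 1
    push_cast
    ring
  | pred i ih =>
    rw [← ih, ← hper _ (hmem (-i - 1))]
    congr 1
    push_cast
    ring

theorem sin_angle_eq_zero {T : ℝ} (hT : 0 < T) {t : ℝ} {z : ℂ} :
    Complex.sin (Real.pi * (z - t) / T) = 0 ↔ ∃ k : ℤ, z = t + k * T := by
  have hT' : (T : ℂ) ≠ 0 := by exact_mod_cast hT.ne'
  have hpi : (Real.pi : ℂ) ≠ 0 := by exact_mod_cast Real.pi_ne_zero
  rw [Complex.sin_eq_zero_iff]
  refine exists_congr fun k => ?_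
  rw [div_eq_iff hT', show (k : ℂ) * Real.pi * T = Real.pi * (k * T) by ring,
    mul_right_inj' hpi, sub_eq_iff_eq_add']

theorem analyticAt_kernel {T t : ℝ} {z : ℂ} (hs : Complex.sin (Real.pi * (z - t) / T) ≠ 0) :
    AnalyticAt ℂ (kernel T t) z := by
  have hθ : AnalyticAt ℂ (fun z : ℂ => Real.pi * (z - t) / T) z := by fun_prop
  exact (Complex.analyticAt_cos.comp hθ).div ((Complex.analyticAt_sin.comp hθ).pow 3)
    (pow_ne_zero 3 hs)

theorem analyticAt_singularPart {T t : ℝ} {z : ℂ} (u : ℂ → ℂ)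
    (hs : Complex.sin (Real.pi * (z - t) / T) ≠ 0) :
    AnalyticAt ℂ (singularPart T t u) z := by
  have hθ : AnalyticAt ℂ (fun z : ℂ => Real.pi * (z - t) / T) z := by fun_prop
  have hsin := Complex.analyticAt_sin.comp hθ
  exact ((analyticAt_const.mul (analyticAt_kernel hs)).add
    (analyticAt_const.div (hsin.pow 2) (pow_ne_zero 2 hs))).add
    (analyticAt_const.mul ((Complex.analyticAt_cos.comp hθ).div hsin hs))

theorem eventually_sin_angle_ne {T t : ℝ} {z : ℂ}
    (hs : Complex.sin (Real.pi * (z - t) / T) ≠ 0) :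
    ∀ᶠ w in 𝓝 z, Complex.sin (Real.pi * (w - t) / T) ≠ 0 := by
  have : ContinuousAt (fun w : ℂ => Complex.sin (Real.pi * (w - t) / T)) z := by fun_prop
  exact this.eventually_ne hs

theorem exists_sin_cos_angle_expansion (T t : ℝ) : ∃ p q : ℂ → ℂ,
    AnalyticAt ℂ p t ∧ AnalyticAt ℂ q t ∧ p t = 0 ∧ q t = 0 ∧
    (∀ z, Complex.sin (Real.pi * (z - t) / T) = Real.pi * (z - t) / T
      * (1 - (Real.pi * (z - t) / T) ^ 2 * (1 / 6 - Real.pi * (z - t) / T * p z))) ∧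
    ∀ z, Complex.cos (Real.pi * (z - t) / T) = 1 - (Real.pi * (z - t) / T) ^ 2 / 2
      + (Real.pi * (z - t) / T) ^ 3 * q z := by
  obtain ⟨p, hp, hp0, hsin⟩ := exists_sin_expansion
  obtain ⟨q, hq, hq0, hcos⟩ := exists_cos_expansion
  have hθ : AnalyticAt ℂ (fun z : ℂ => Real.pi * (z - t) / T) t := by fun_prop
  have h0 : (Real.pi : ℂ) * ((t : ℂ) - t) / T = 0 := by simp
  refine ⟨fun z => p (Real.pi * (z - t) / T), fun z => q (Real.pi * (z - t) / T),
    AnalyticAt.fun_comp (by rwa [h0]) hθ, AnalyticAt.fun_comp (by rwa [h0]) hθ, by simpa using hp0,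
    by simpa using hq0, fun z => ?_, fun z => ?_⟩
  · rw [hsin]; ring
  · rw [hcos]

theorem exists_quadratic_expansion {u : ℂ → ℂ} {t : ℂ} (hu : AnalyticAt ℂ u t) :
    ∃ r : ℂ → ℂ, AnalyticAt ℂ r t ∧ r t = iteratedDeriv 3 u t / 6 ∧
    ∀ z, u z = u t + deriv u t * (z - t) + iteratedDeriv 2 u t / 2 * (z - t) ^ 2
      + (z - t) ^ 3 * r z := by
  obtain ⟨r, hr, hr0, h⟩ := hu.exists_taylor 3
  refine ⟨r, hr, by rw [hr0]; simp [Nat.factorial], fun z => (h z).trans ?_⟩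
  simp [Finset.sum_range_succ]

/-- With κ = T/π, z - t = κθ, and K = θ⁻³ + O(θ), 1/sin² θ = θ⁻² + 1/3 + O(θ²), cot θ = θ⁻¹ + O(θ),
all negative powers cancel. The constant left is κ³ u'''(t)/6 - κ u'(t)/3, the value assigned at the
zeros of the sine. -/
theorem analyticAt_subtracted {T t : ℝ} (hT : 0 < T) {u : ℂ → ℂ} (hu : AnalyticAt ℂ u t) :
    AnalyticAt ℂ (subtracted T t u) t := by
  have hT' : (T : ℂ) ≠ 0 := by exact_mod_cast hT.ne'
  have hpi : (Real.pi : ℂ) ≠ 0 := by exact_mod_cast Real.pi_ne_zero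
  obtain ⟨p, q, hp, hq, hp0, hq0, hsin, hcos⟩ := exists_sin_cos_angle_expansion T t
  obtain ⟨r, hr, hr0, hur⟩ := exists_quadratic_expansion hu
  set θ : ℂ → ℂ := fun z => Real.pi * (z - t) / T with hθd
  have hθ : AnalyticAt ℂ θ t := by fun_prop
  have hθt : θ t = 0 := by simp [hθd]
  set s : ℂ → ℂ := fun z => 1 / 6 - θ z * p z with hsd
  have hs : AnalyticAt ℂ s t := analyticAt_const.sub (hθ.mul hp)
  have hst : s t = 1 / 6 := by simp [hsd, hθt]
  have hden : AnalyticAt ℂ (fun z => 1 - θ z ^ 2 * s z) t :=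
    analyticAt_const.sub ((hθ.pow 2).mul hs)
  have hden0 : 1 - θ t ^ 2 * s t ≠ 0 := by simp [hθt]
  have hcosθ : AnalyticAt ℂ (fun z => Complex.cos (θ z)) t := Complex.analyticAt_cos.comp hθ
  -- The quotient after cancelling θ³, using sin θ = θ(1 - θ² s).
  set E : ℂ → ℂ := fun z => (T / Real.pi * deriv u t * (-1 / 2 + θ z * q z + s z)
    + (T : ℂ) ^ 2 / (2 * (Real.pi : ℂ) ^ 2) * iteratedDeriv 2 u t
      * (θ z * (Complex.cos (θ z) * (2 * s z - θ z ^ 2 * s z ^ 2)))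
    + ((T : ℂ) / Real.pi) ^ 3 * (Complex.cos (θ z) * r z)) / (1 - θ z ^ 2 * s z) ^ 3 with hE
  have hEan : AnalyticAt ℂ E t := by
    refine AnalyticAt.div (AnalyticAt.add (AnalyticAt.add ?_ ?_) ?_) (hden.pow 3)
      (pow_ne_zero 3 hden0)
    · exact analyticAt_const.mul ((analyticAt_const.add (hθ.mul hq)).add hs)
    · exact analyticAt_const.mul (hθ.mul (hcosθ.mul ((analyticAt_const.mul hs).sub
        ((hθ.pow 2).mul (hs.pow 2)))))
    · exact analyticAt_const.mul (hcosθ.mul hr)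
  refine hEan.congr ?_
  filter_upwards [hden.continuousAt.eventually_ne hden0] with z hz
  by_cases hzt : z = t
  · subst hzt
    rw [subtracted, if_pos (by simp)]
    simp only [hE, hθt, hst, hr0]
    simp
    ring
  · have hθz : θ z ≠ 0 := by
      simp only [hθd]
      exact div_ne_zero (mul_ne_zero hpi (sub_ne_zero.mpr hzt)) hT'
    have hS : Complex.sin (θ z) = θ z * (1 - θ z ^ 2 * s z) := hsin z
    have hC : Complex.cos (θ z) = 1 - θ z ^ 2 / 2 + θ z ^ 3 * q z := hcos z
    have hS0 : Complex.sin (θ z) ≠ 0 := by rw [hS]; exact mul_ne_zero hθz hz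
    rw [subtracted_of_ne hS0, singularPart, kernel, hur z]
    have hv : z - t = T / Real.pi * θ z := by simp only [hθd]; field_simp
    change E z = Complex.cos (θ z) / Complex.sin (θ z) ^ 3 * _ - (u t *
      (Complex.cos (θ z) / Complex.sin (θ z) ^ 3) + T / Real.pi * deriv u t / Complex.sin (θ z) ^ 2
      + (T : ℂ) ^ 2 / (2 * (Real.pi : ℂ) ^ 2) * iteratedDeriv 2 u t
        * (Complex.cos (θ z) / Complex.sin (θ z)))
    rw [hv, hS]
    simp only [hE]
    have hB : (T : ℂ) ^ 2 / (2 * (Real.pi : ℂ) ^ 2) = ((T : ℂ) / Real.pi) ^ 2 / 2 := by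
      field_simp
    rw [hB]
    generalize (T : ℂ) / Real.pi = κ
    rw [div_eq_iff (pow_ne_zero 3 hz)]
    generalize Complex.cos (θ z) = c at *
    generalize θ z = x at *
    generalize s z = y at *
    -- Only the u'(t) terms need the expansion of the cosine: cos θ - (1 - θ² s) = θ²(-1/2 + θ q +
    -- s).
    have key : (κ * deriv u t * (-1 / 2 + x * q z + y)
        + κ ^ 2 / 2 * iteratedDeriv 2 u t * (x * (c * (2 * y - x ^ 2 * y ^ 2)))
        + κ ^ 3 * (c * r z)) * x ^ 3 = c * (deriv u t * (κ * x)
        + iteratedDeriv 2 u t / 2 * (κ * x) ^ 2 + (κ * x) ^ 3 * r z)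
        - κ * deriv u t * x * (1 - x ^ 2 * y)
        - κ ^ 2 / 2 * iteratedDeriv 2 u t * c * x ^ 2 * (1 - x ^ 2 * y) ^ 2 := by
      linear_combination (-deriv u t * κ * x) * hC
    rw [← mul_left_inj' (pow_ne_zero 3 hθz), key]
    generalize 1 - x ^ 2 * y = D at *
    field_simp
    ring

theorem analyticOnNhd_subtracted {σ T t : ℝ} (hT : 0 < T) (hσ : 0 < σ) {u : ℂ → ℂ}
    (hu : AnalyticOnNhd ℂ u (strip σ)) (hper : ∀ z ∈ strip σ, u (z + T) = u z) :
    AnalyticOnNhd ℂ (subtracted T t u) (strip σ) := by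
  intro z hz
  have ht : (t : ℂ) ∈ strip σ := by simpa [strip] using hσ
  by_cases hs : Complex.sin (Real.pi * (z - t) / T) = 0
  · obtain ⟨k, rfl⟩ := (sin_angle_eq_zero hT).mp hs
    -- The other zeros t + kT of the sine are carried to t by periodicity.
    have h1 : AnalyticAt ℂ (fun w : ℂ => subtracted T t u (w - k * T)) (t + k * T) :=
      AnalyticAt.fun_comp (by simpa using analyticAt_subtracted hT (hu _ ht)) (by fun_prop)
    refine h1.congr ?_
    filter_upwards [(isOpen_strip σ).mem_nhds hz] with w hw
    have hw' : w - k * T ∈ strip σ := by simpa [strip] using hw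
    rw [← eq_of_add_int_mul (fun z hz => subtracted_add_period hT (t := t) (hper z hz)) hw' k,
      sub_add_cancel]
  · refine (((analyticAt_kernel hs).mul (hu z hz)).sub (analyticAt_singularPart u hs)).congr ?_
    filter_upwards [eventually_sin_angle_ne hs] with w hw
    rw [subtracted_of_ne hw]
    rfl

/-! ### The regular factor g: smoothness and derivatives at t. -/

theorem regularFactor_of_ne {f : ℝ → ℂ} {t x : ℝ} (h : x ≠ t) :
    regularFactor f t x = ((x - t : ℝ) : ℂ) ^ 3 * f x :=
  Function.update_of_ne h _ _

/-- The third-order expansion of the regular factor at the singular point. -/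
theorem exists_regularFactor_expansion {T t : ℝ} (hT : 0 < T) {u : ℂ → ℂ} (hu : AnalyticAt ℂ u t) :
    ∃ R : ℝ → ℂ, AnalyticAt ℝ R t ∧
      R t = ((T : ℂ) / Real.pi) ^ 3 * (iteratedDeriv 3 u t / 6) ∧
      regularFactor (integrand T t u) t =ᶠ[𝓝 t] fun x : ℝ =>
        ((T : ℂ) / Real.pi) ^ 3 * u t + ((T : ℂ) / Real.pi) ^ 3 * deriv u t * ((x : ℂ) - t)
        + ((T : ℂ) / Real.pi) ^ 3 * (iteratedDeriv 2 u t / 2) * ((x : ℂ) - t) ^ 2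
        + ((x : ℂ) - t) ^ 3 * R x := by
  have hT' : (T : ℂ) ≠ 0 := by exact_mod_cast hT.ne'
  have hpi : (Real.pi : ℂ) ≠ 0 := by exact_mod_cast Real.pi_ne_zero
  obtain ⟨p, q, hp, hq, hp0, hq0, hsin, hcos⟩ := exists_sin_cos_angle_expansion T t
  obtain ⟨r, hr, hr0, hur⟩ := exists_quadratic_expansion hu
  set θ : ℂ → ℂ := fun z => Real.pi * (z - t) / T with hθd
  have hθ : AnalyticAt ℂ θ t := by fun_prop
  have hθt : θ t = 0 := by simp [hθd]
  set s : ℂ → ℂ := fun z => 1 / 6 - θ z * p z with hsd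
  have hs : AnalyticAt ℂ s t := analyticAt_const.sub (hθ.mul hp)
  have hden : AnalyticAt ℂ (fun z => 1 - θ z ^ 2 * s z) t :=
    analyticAt_const.sub ((hθ.pow 2).mul hs)
  have hden0 : 1 - θ t ^ 2 * s t ≠ 0 := by simp [hθt]
  -- Chosen so that θ³ K = 1 + θ³ e: the numerator is (cos θ - (1 - θ² s)³)/θ³, the θ² terms
  -- cancelling. As e(t) = 0, the expansion of g agrees with that of (T/π)³ u through third order.
  set e : ℂ → ℂ := fun z => (q z - 3 * p z - 3 * θ z * s z ^ 2 + θ z ^ 3 * s z ^ 3)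
    / (1 - θ z ^ 2 * s z) ^ 3 with he
  have hean : AnalyticAt ℂ e t := by
    refine AnalyticAt.div (AnalyticAt.add (AnalyticAt.sub (hq.sub (analyticAt_const.mul hp)) ?_) ?_)
      (hden.pow 3) (pow_ne_zero 3 hden0)
    · exact (analyticAt_const.mul hθ).mul (hs.pow 2)
    · exact (hθ.pow 3).mul (hs.pow 3)
  have het : e t = 0 := by simp [he, hθt, hp0, hq0]
  set R : ℂ → ℂ := fun z => ((T : ℂ) / Real.pi) ^ 3 * r z + e z * u z with hR
  have hRan : AnalyticAt ℂ R t := (analyticAt_const.mul hr).add (hean.mul hu)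
  have hRre : AnalyticAt ℝ (fun x : ℝ => R x) t :=
    AnalyticAt.fun_comp (g := R) (hRan.restrictScalars (𝕜 := ℝ)) (Complex.ofRealCLM.analyticAt t)
  set w : ℝ → ℂ := fun x : ℝ =>
        ((T : ℂ) / Real.pi) ^ 3 * u t + ((T : ℂ) / Real.pi) ^ 3 * deriv u t * ((x : ℂ) - t)
        + ((T : ℂ) / Real.pi) ^ 3 * (iteratedDeriv 2 u t / 2) * ((x : ℂ) - t) ^ 2
        + ((x : ℂ) - t) ^ 3 * R x with hw
  have hwc : ContinuousAt w t :=
    (by fun_prop : ContinuousAt (fun x : ℝ => ((T : ℂ) / Real.pi) ^ 3 * u t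
      + ((T : ℂ) / Real.pi) ^ 3 * deriv u t * ((x : ℂ) - t)
        + ((T : ℂ) / Real.pi) ^ 3 * (iteratedDeriv 2 u t / 2) * ((x : ℂ) - t) ^ 2) t).add
      ((by fun_prop : ContinuousAt (fun x : ℝ => ((x : ℂ) - t) ^ 3) t).mul hRre.continuousAt)
  have hev : ∀ᶠ x : ℝ in 𝓝[≠] t, ((x - t : ℝ) : ℂ) ^ 3 * integrand T t u x = w x := by
    have h1 := (Complex.continuous_ofReal.continuousAt (x := t)).eventually
      (hden.continuousAt.eventually_ne hden0)
    filter_upwards [h1.filter_mono nhdsWithin_le_nhds, self_mem_nhdsWithin] with x hz hxt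
    have hxt' : (x : ℂ) - t ≠ 0 := sub_ne_zero.mpr (by exact_mod_cast hxt)
    have hθz : θ x ≠ 0 := div_ne_zero (mul_ne_zero hpi hxt') hT'
    have hS : Complex.sin (θ x) = θ x * (1 - θ x ^ 2 * s x) := hsin x
    have hC : Complex.cos (θ x) = 1 - θ x ^ 2 / 2 + θ x ^ 3 * q x := hcos x
    have hv : (x : ℂ) - t = T / Real.pi * θ x := by simp only [hθd]; field_simp
    have hce : Complex.cos (θ x) = (1 + θ x ^ 3 * e x) * (1 - θ x ^ 2 * s x) ^ 3 := by
      have : e x * (1 - θ x ^ 2 * s x) ^ 3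
          = q x - 3 * p x - 3 * θ x * s x ^ 2 + θ x ^ 3 * s x ^ 3 :=
        div_mul_cancel₀ _ (pow_ne_zero 3 hz)
      rw [hC, add_mul, mul_assoc, this]
      simp only [hsd]
      ring
    have hK : ((x - t : ℝ) : ℂ) ^ 3 * kernel T t x
        = ((T : ℂ) / Real.pi) ^ 3 * (1 + θ x ^ 3 * e x) := by
      change _ * (Complex.cos (θ x) / Complex.sin (θ x) ^ 3) = _
      rw [hS, hce, Complex.ofReal_sub, hv]
      field_simp
    rw [integrand, ← mul_assoc, hK]
    simp only [hw, hR]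
    have h3 : ((x : ℂ) - t) ^ 3 = ((T : ℂ) / Real.pi) ^ 3 * θ x ^ 3 := by rw [hv]; ring
    have := hur x
    linear_combination ((T : ℂ) / Real.pi) ^ 3 * this - e x * u x * h3
  have hlim : limUnder (𝓝[≠] t) (fun x : ℝ => ((x - t : ℝ) : ℂ) ^ 3 * integrand T t u x) = w t :=
    Tendsto.limUnder_eq ((hwc.tendsto.mono_left nhdsWithin_le_nhds).congr'
      (hev.mono fun x hx => hx.symm))
  refine ⟨fun x => R x, hRre, by simp [hR, het, hr0], ?_⟩
  filter_upwards [eventually_nhdsWithin_iff.mp hev] with x hx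
  by_cases hxt : x = t
  · subst hxt
    rw [regularFactor, Function.update_self, hlim]
  · rw [regularFactor_of_ne hxt, hx hxt]

theorem derivs_regularFactor {T t : ℝ} (hT : 0 < T) {u : ℂ → ℂ} (hu : AnalyticAt ℂ u t) :
    deriv (regularFactor (integrand T t u) t) t = ((T : ℂ) / Real.pi) ^ 3 * deriv u t ∧
    iteratedDeriv 3 (regularFactor (integrand T t u) t) t
      = ((T : ℂ) / Real.pi) ^ 3 * iteratedDeriv 3 u t := by
  obtain ⟨R, hR, hRt, h⟩ := exists_regularFactor_expansion hT hu
  obtain ⟨h1, h3⟩ := derivs_of_expansion hR h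
  exact ⟨h1, by rw [h3, hRt]; ring⟩

theorem sin_angle_ne_zero_of_mem {a b t : ℝ} (hat : a < t) (htb : t < b) {x : ℝ} (hx : x ∈ Icc a b)
    (hxt : x ≠ t) : Complex.sin (Real.pi * ((x : ℂ) - t) / (b - a : ℝ)) ≠ 0 := by
  have hT : 0 < b - a := by linarith
  intro h
  obtain ⟨k, hk⟩ := (sin_angle_eq_zero hT).mp h
  have hk : x = t + k * (b - a) := by exact_mod_cast hk
  have h1 : |(k : ℝ)| * (b - a) < 1 * (b - a) := by
    rw [← abs_of_pos hT, ← abs_mul, abs_of_pos hT, abs_lt]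
    constructor <;> linarith [hx.1, hx.2]
  have h2 : |(k : ℝ)| < 1 := lt_of_mul_lt_mul_right h1 hT.le
  have h3 : k = 0 := Int.abs_lt_one_iff.mp (by exact_mod_cast h2)
  exact hxt (by rw [hk, h3]; simp)

theorem contDiffOn_regularFactor {a b t σ : ℝ} (hat : a < t) (htb : t < b) (hσ : 0 < σ)
    {u : ℂ → ℂ} (hu : AnalyticOnNhd ℂ u (strip σ)) :
    ContDiffOn ℝ ∞ (regularFactor (integrand (b - a) t u) t) (Icc a b) := by
  have hT : 0 < b - a := by linarith
  intro x hx
  have hmem : ∀ r : ℝ, (r : ℂ) ∈ strip σ := fun r => by simpa [strip] using hσ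
  refine ContDiffAt.contDiffWithinAt (AnalyticAt.contDiffAt ?_)
  by_cases hxt : x = t
  · subst hxt
    obtain ⟨R, hR, hRt, h⟩ := exists_regularFactor_expansion hT (hu _ (hmem x))
    refine AnalyticAt.congr ?_ h.symm
    have hv : AnalyticAt ℝ (fun y : ℝ => (y : ℂ) - x) x :=
      (Complex.ofRealCLM.analyticAt x).sub analyticAt_const
    exact ((analyticAt_const.add (analyticAt_const.mul hv)).add
      (analyticAt_const.mul (hv.pow 2))).add ((hv.pow 3).mul hR)
  · have hs := sin_angle_ne_zero_of_mem hat htb hx hxt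
    have h1 : AnalyticAt ℂ (fun z : ℂ => (z - t) ^ 3 * (kernel (b - a) t z * u z)) x :=
      (by fun_prop : AnalyticAt ℂ (fun z : ℂ => (z - t) ^ 3) x).mul
        ((analyticAt_kernel hs).mul (hu _ (hmem x)))
    have h2 : AnalyticAt ℝ (fun y : ℝ => ((y : ℂ) - t) ^ 3 * (kernel (b - a) t y * u y)) x :=
      AnalyticAt.fun_comp (g := fun z : ℂ => (z - t) ^ 3 * (kernel (b - a) t z * u z))
        (h1.restrictScalars (𝕜 := ℝ)) (Complex.ofRealCLM.analyticAt x)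
    refine h2.congr ?_
    filter_upwards [isOpen_ne.mem_nhds hxt] with y hy
    rw [regularFactor_of_ne hy, Complex.ofReal_sub, integrand]

/-! ### The Hadamard finite part. -/

/-- The limit is 0, so discarding the 1/ε term of cot(πε/T) leaves no constant in the finite part.
-/
theorem tendsto_cot_sub_inv : Tendsto (fun z : ℂ => Complex.cot z - 1 / z) (𝓝[≠] 0) (𝓝 0) := by
  obtain ⟨p, hp, hp0, hsin⟩ := exists_sin_expansion
  obtain ⟨q, hq, hq0, hcos⟩ := exists_cos_expansion
  have hden : ContinuousAt (fun z => 1 - z ^ 2 / 6 + z ^ 3 * p z) 0 :=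
    (by fun_prop : ContinuousAt (fun z : ℂ => 1 - z ^ 2 / 6) 0).add
      ((continuousAt_id.pow 3).mul hp.continuousAt)
  have hnum : ContinuousAt (fun z => z * (-1 / 3 + z * (q z - p z))) 0 :=
    continuousAt_id.mul (continuousAt_const.add
      (continuousAt_id.mul (hq.continuousAt.sub hp.continuousAt)))
  have hlim : Tendsto (fun z => z * (-1 / 3 + z * (q z - p z)) / (1 - z ^ 2 / 6 + z ^ 3 * p z))
      (𝓝[≠] 0) (𝓝 (0 * (-1 / 3 + 0 * (q 0 - p 0)) / (1 - 0 ^ 2 / 6 + 0 ^ 3 * p 0))) :=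
    (hnum.div hden (by simp)).tendsto.mono_left nhdsWithin_le_nhds
  rw [zero_mul, zero_div] at hlim
  refine hlim.congr' ?_
  filter_upwards [(hden.eventually_ne (y := 0) (by simp)).filter_mono nhdsWithin_le_nhds,
    self_mem_nhdsWithin] with z hz hz0
  have hz0 : z ≠ 0 := hz0
  have hS : Complex.sin z = z * (1 - z ^ 2 / 6 + z ^ 3 * p z) := by rw [hsin z]; ring
  rw [Complex.cot, hS, hcos z, div_sub_div _ _ (mul_ne_zero hz0 hz) hz0,
    div_eq_div_iff hz (mul_ne_zero (mul_ne_zero hz0 hz) hz0)]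
  ring

/-- A primitive of `singularPart` on the real line. -/
noncomputable def singularPrimitive (T t : ℝ) (u : ℂ → ℂ) (x : ℝ) : ℂ :=
  u t * (-(T / (2 * Real.pi)) / Complex.sin (Real.pi * ((x : ℂ) - t) / T) ^ 2)
    + T / Real.pi * deriv u t * (-(T / Real.pi) * Complex.cot (Real.pi * ((x : ℂ) - t) / T))
    + (T : ℂ) ^ 2 / (2 * (Real.pi : ℂ) ^ 2) * iteratedDeriv 2 u t
      * (T / Real.pi * (Real.log (Real.sin (Real.pi * (x - t) / T)) : ℂ))

theorem hasDerivAt_singularPrimitive {T t x : ℝ} (hT : 0 < T) (u : ℂ → ℂ)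
    (hs : Complex.sin (Real.pi * ((x : ℂ) - t) / T) ≠ 0) :
    HasDerivAt (singularPrimitive T t u) (singularPart T t u x) x := by
  have hT' : (T : ℂ) ≠ 0 := by exact_mod_cast hT.ne'
  have hpi : (Real.pi : ℂ) ≠ 0 := by exact_mod_cast Real.pi_ne_zero
  have hs' : Real.sin (Real.pi * (x - t) / T) ≠ 0 := fun h => hs (by exact_mod_cast congrArg Complex.ofReal h)
  have hθ : HasDerivAt (fun z : ℂ => Real.pi * (z - t) / T) (Real.pi / T) (x : ℂ) := by
    simpa using (((hasDerivAt_id (x : ℂ)).sub_const (t : ℂ)).const_mul (Real.pi : ℂ)).div_const (T : ℂ)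
  have hθr : HasDerivAt (fun y : ℝ => Real.pi * (y - t) / T) (Real.pi / T) x := by
    simpa using (((hasDerivAt_id x).sub_const t).const_mul Real.pi).div_const T
  have h1 := (((((Complex.hasDerivAt_sin _).comp (x : ℂ) hθ).pow 2).fun_inv
    (pow_ne_zero 2 hs)).const_mul (-((T : ℂ) / (2 * Real.pi)))).comp_ofReal
  have h2 := (((hasDerivAt_cot hs).comp (x : ℂ) hθ).const_mul (-((T : ℂ) / Real.pi))).comp_ofReal
  have h3 := ((((Real.hasDerivAt_sin _).comp x hθr).log hs').ofReal_comp).const_mul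
    ((T : ℂ) / Real.pi)
  have h := ((h1.const_mul (u t)).add (h2.const_mul (T / Real.pi * deriv u t))).add
    (h3.const_mul ((T : ℂ) ^ 2 / (2 * (Real.pi : ℂ) ^ 2) * iteratedDeriv 2 u t))
  refine (h.congr_of_eventuallyEq (Eventually.of_forall fun y => ?_)).congr_deriv ?_
  · simp [singularPrimitive, div_eq_mul_inv]
  · simp only [singularPart, kernel, Function.comp_apply, Pi.pow_apply]
    push_cast
    generalize Complex.sin (Real.pi * ((x : ℂ) - t) / T) = s at *
    generalize Complex.cos (Real.pi * ((x : ℂ) - t) / T) = c at *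
    field_simp

/-- The logarithmic term is periodic because `Real.log` depends only on the absolute value; the same
primitive thus serves on both sides of t. -/
theorem singularPrimitive_add_period {T : ℝ} (hT : 0 < T) (t : ℝ) (u : ℂ → ℂ) (x : ℝ) :
    singularPrimitive T t u (x + T) = singularPrimitive T t u x := by
  have h : Real.pi * (x + T - t) / T = Real.pi * (x - t) / T + Real.pi := by
    field_simp
    ring
  have h' := angle_add hT t (x : ℂ)
  simp only [singularPrimitive, h, Complex.ofReal_add, h', Complex.sin_add_pi, Real.sin_add_pi,
    Complex.cot, Complex.cos_add_pi, neg_div_neg_eq, neg_sq, Real.log_neg_eq_log]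

/-- The 1/sin² and logarithmic terms are even about t and cancel; only the odd cotangent survives.
-/
theorem singularPrimitive_sub (T t : ℝ) (u : ℂ → ℂ) (ε : ℝ) :
    singularPrimitive T t u (t - ε) - singularPrimitive T t u (t + ε)
      = 2 * (T / Real.pi) ^ 2 * deriv u t * Complex.cot (Real.pi * ε / T) := by
  have h1 : Real.pi * (t - ε - t) / T = -(Real.pi * ε / T) := by ring
  have h2 : Real.pi * (t + ε - t) / T = Real.pi * ε / T := by ring
  have h3 : (Real.pi : ℂ) * (t - ε - t) / T = -(Real.pi * ε / T) := by ring
  have h4 : (Real.pi : ℂ) * (t + ε - t) / T = Real.pi * ε / T := by ring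
  simp only [singularPrimitive, h1, h2, Complex.ofReal_add, Complex.ofReal_sub, h3, h4,
    Complex.sin_neg, Real.sin_neg, Complex.cot, Complex.cos_neg, neg_sq, Real.log_neg_eq_log,
    div_neg]
  ring

theorem integrand_eq {T t : ℝ} (u : ℂ → ℂ) {x : ℝ}
    (hs : Complex.sin (Real.pi * ((x : ℂ) - t) / T) ≠ 0) :
    integrand T t u x = subtracted T t u x + singularPart T t u x := by
  rw [subtracted_of_ne hs, integrand, sub_add_cancel]

theorem hasFinitePart_integrand {a b t σ : ℝ} (hat : a < t) (htb : t < b) (hσ : 0 < σ)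
    {u : ℂ → ℂ} (hu : AnalyticOnNhd ℂ u (strip σ))
    (hper : ∀ z ∈ strip σ, u (z + (b - a : ℝ)) = u z) :
    HasFinitePart (integrand (b - a) t u) a b t (∫ x in a..b, subtracted (b - a) t u x) := by
  set T := b - a with hTd
  have hT : 0 < T := by linarith
  have hT' : (T : ℂ) ≠ 0 := by exact_mod_cast hT.ne'
  have hpi : (Real.pi : ℂ) ≠ 0 := by exact_mod_cast Real.pi_ne_zero
  have hG : Continuous fun x : ℝ => subtracted T t u x := by
    have := continuous_line (analyticOnNhd_subtracted hT hσ hu hper (t := t)).differentiableOn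
      (y := 0) (by simpa using hσ)
    simpa using this
  have hsub : ∀ ⦃c d : ℝ⦄, c ≤ d → (∀ x ∈ Icc c d, x ∈ Icc a b ∧ x ≠ t) →
      IntervalIntegrable (integrand T t u) volume c d ∧
      ∫ x in c..d, integrand T t u x = (∫ x in c..d, subtracted T t u x)
        + (singularPrimitive T t u d - singularPrimitive T t u c) := by
    intro c d hcd hmem
    have hs : ∀ x ∈ uIcc c d, Complex.sin (Real.pi * ((x : ℂ) - t) / T) ≠ 0 := by
      intro x hx
      rw [uIcc_of_le hcd] at hx
      exact sin_angle_ne_zero_of_mem hat htb (hmem x hx).1 (hmem x hx).2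
    have hsc : ContinuousOn (fun x : ℝ => singularPart T t u x) (uIcc c d) := fun x hx =>
      ((analyticAt_singularPart u (hs x hx)).continuousAt.comp
        Complex.continuous_ofReal.continuousAt).continuousWithinAt
    have hsi := hsc.intervalIntegrable (μ := volume)
    have heq : ∀ x ∈ uIcc c d, subtracted T t u x + singularPart T t u x = integrand T t u x :=
      fun x hx => (integrand_eq u (hs x hx)).symm
    have hGi := hG.intervalIntegrable (μ := volume) c d
    refine ⟨(hGi.add hsi).congr fun x hx => heq x (uIoc_subset_uIcc hx), ?_⟩
    rw [← intervalIntegral.integral_congr heq, intervalIntegral.integral_add hGi hsi,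
      intervalIntegral.integral_eq_sub_of_hasDerivAt
        (fun x hx => hasDerivAt_singularPrimitive hT u (hs x hx)) hsi]
  have hev : ∀ᶠ ε : ℝ in 𝓝[>] 0, 0 < ε ∧ ε < t - a ∧ ε < b - t := by
    filter_upwards [Ioo_mem_nhdsGT (show (0 : ℝ) < min (t - a) (b - t) from
      lt_min (by linarith) (by linarith))] with ε hε
    exact ⟨hε.1, hε.2.trans_le (min_le_left _ _), hε.2.trans_le (min_le_right _ _)⟩
  have hsplit : ∀ ε : ℝ, 0 < ε ∧ ε < t - a ∧ ε < b - t → _ ∧ _ := fun ε hε =>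
    And.intro (hsub (c := a) (d := t - ε) (by linarith) fun x hx =>
        ⟨⟨hx.1, by linarith [hx.2]⟩, by linarith [hx.2] |> fun h : x < t => h.ne⟩)
      (hsub (c := t + ε) (d := b) (by linarith) fun x hx =>
        ⟨⟨by linarith [hx.1], hx.2⟩, by linarith [hx.1] |> fun h : t < x => h.ne'⟩)
  -- No logarithm and no 1/ε² occur, by the evenness of their terms about t. The 1/ε coefficient is
  -- 2(T/π)² u'(t) times the factor T/π from cot(πε/T) ~ T/(πε).
  refine ⟨hev.mono fun ε hε => ⟨(hsplit ε hε).1.1, (hsplit ε hε).2.1⟩, 0,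
    2 * (T / Real.pi) ^ 3 * deriv u t, 0, ?_⟩
  have hε0 : Tendsto (fun ε : ℝ => ε) (𝓝[>] 0) (𝓝 0) := nhdsWithin_le_nhds
  have hprim := intervalIntegral.continuous_primitive (μ := volume)
    (fun c d => hG.intervalIntegrable (μ := volume) c d)
  have hI1 : Tendsto (fun ε : ℝ => ∫ x in a..t - ε, subtracted T t u x) (𝓝[>] 0)
      (𝓝 (∫ x in a..t, subtracted T t u x)) := by
    have := ((hprim a).tendsto (t - 0)).comp (hε0.const_sub t)
    simpa [Function.comp_def] using this
  have hI2 : Tendsto (fun ε : ℝ => ∫ x in t + ε..b, subtracted T t u x) (𝓝[>] 0)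
      (𝓝 (∫ x in t..b, subtracted T t u x)) := by
    have := (((hprim b).tendsto (t + 0)).comp (hε0.const_add t)).neg
    simpa [Function.comp_def, ← intervalIntegral.integral_symm] using this
  have hscale : Tendsto (fun ε : ℝ => (Real.pi : ℂ) * ε / T) (𝓝[>] 0) (𝓝[≠] 0) := by
    refine tendsto_nhdsWithin_iff.mpr ⟨?_, ?_⟩
    · have : ContinuousAt (fun ε : ℝ => (Real.pi : ℂ) * ε / T) 0 := by fun_prop
      simpa using this.tendsto.mono_left (nhdsWithin_le_nhds (s := Ioi 0))
    · filter_upwards [self_mem_nhdsWithin] with ε hε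
      have : (ε : ℂ) ≠ 0 := by exact_mod_cast (ne_of_gt hε)
      exact div_ne_zero (mul_ne_zero hpi this) hT'
  have hcot := (tendsto_cot_sub_inv.comp hscale).const_mul (2 * ((T : ℂ) / Real.pi) ^ 2 * deriv u t)
  have hfin := (hI1.add hI2).add hcot
  rw [mul_zero, add_zero, intervalIntegral.integral_add_adjacent_intervals
    (hG.intervalIntegrable _ _) (hG.intervalIntegrable _ _)] at hfin
  refine hfin.congr' ?_
  filter_upwards [hev] with ε hε
  have hε' : (ε : ℂ) ≠ 0 := by exact_mod_cast hε.1.ne'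
  rw [(hsplit ε hε).1.2, (hsplit ε hε).2.2]
  have h1 := singularPrimitive_sub T t u ε
  have h2 : singularPrimitive T t u b = singularPrimitive T t u a := by
    rw [← singularPrimitive_add_period hT t u a, hTd, add_sub_cancel]
  have h3 : 2 * ((T : ℂ) / Real.pi) ^ 2 * deriv u t * (1 / (Real.pi * ε / T))
      = 2 * (T / Real.pi) ^ 3 * deriv u t / ε := by
    field_simp
  simp only [Function.comp_apply]
  linear_combination -h2 - h1 - h3

/-! ### The quadrature formulas as trapezoidal sums. -/

theorem sum_singularPart_interior {T : ℝ} (hT : 0 < T) (t : ℝ) (u : ℂ → ℂ) {n : ℕ} (hn : 1 ≤ n) :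
    ∑ j ∈ Finset.Ico 1 n, singularPart T t u ((t + j * (T / n) : ℝ) : ℂ)
      = T / Real.pi * deriv u t * (((n : ℂ) ^ 2 - 1) / 3) := by
  have hT' : (T : ℂ) ≠ 0 := by exact_mod_cast hT.ne'
  have hn0 : (n : ℂ) ≠ 0 := by exact_mod_cast (by omega : n ≠ 0)
  have hθ : ∀ j : ℕ, (Real.pi : ℂ) * (((t + j * (T / n) : ℝ) : ℂ) - t) / T = Real.pi * j / n := by
    intro j
    push_cast
    field_simp
    ring
  have hrefl : ∀ j ∈ Finset.Ico 1 n, (Real.pi : ℂ) * (n - j : ℕ) / n = Real.pi - Real.pi * j / n := by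
    intro j hj
    rw [Nat.cast_sub (Finset.mem_Ico.mp hj).2.le]
    field_simp
  have h1 := sum_Ico_eq_zero_of_reflect (n := n)
    (F := fun j => Complex.cos (Real.pi * j / n) / Complex.sin (Real.pi * j / n) ^ 3)
    fun j hj => by simp only [hrefl j hj, Complex.cos_pi_sub, Complex.sin_pi_sub, neg_div]
  have h2 := sum_Ico_eq_zero_of_reflect (n := n)
    (F := fun j => Complex.cos (Real.pi * j / n) / Complex.sin (Real.pi * j / n))
    fun j hj => by simp only [hrefl j hj, Complex.cos_pi_sub, Complex.sin_pi_sub, neg_div]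
  have h3 := sum_inv_sin_sq_interior hn
  simp only [singularPart, kernel, hθ]
  rw [Finset.sum_add_distrib, Finset.sum_add_distrib, ← Finset.mul_sum, h1, ← Finset.mul_sum, h2,
    ← h3, Finset.mul_sum]
  simp [div_eq_mul_inv]

theorem sin_midpoint_ne_zero {n : ℕ} (hn : 1 ≤ n) (j : ℕ) :
    Complex.sin (Real.pi / (2 * n) + Real.pi * j / n) ≠ 0 := by
  have hn0 : (n : ℂ) ≠ 0 := by exact_mod_cast (by omega : n ≠ 0)
  refine sin_add_ne_zero hn ?_ j
  rw [show (n : ℂ) * (Real.pi / (2 * n)) = Real.pi / 2 by field_simp, Complex.sin_pi_div_two]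
  exact one_ne_zero

theorem midpoint_angle {T : ℝ} (hT : 0 < T) (t : ℝ) {n : ℕ} (hn : 1 ≤ n) (j : ℕ) :
    (Real.pi : ℂ) * (((t + T / n / 2 + j * (T / n) : ℝ) : ℂ) - t) / T
      = Real.pi / (2 * n) + Real.pi * j / n := by
  have hT' : (T : ℂ) ≠ 0 := by exact_mod_cast hT.ne'
  have hn0 : (n : ℂ) ≠ 0 := by exact_mod_cast (by omega : n ≠ 0)
  push_cast
  field_simp
  ring

/-- The nodes start at angle π/(2n), where sin(nz) = 1, so the 1/sin² sum is n²; reflection j → n -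
1 - j removes the odd terms. -/
theorem sum_singularPart_midpoint {T : ℝ} (hT : 0 < T) (t : ℝ) (u : ℂ → ℂ) {n : ℕ} (hn : 1 ≤ n) :
    ∑ j ∈ Finset.range n, singularPart T t u ((t + T / n / 2 + j * (T / n) : ℝ) : ℂ)
      = T / Real.pi * deriv u t * (n : ℂ) ^ 2 := by
  have hn0 : (n : ℂ) ≠ 0 := by exact_mod_cast (by omega : n ≠ 0)
  have hrefl : ∀ j ∈ Finset.range n, (Real.pi : ℂ) / (2 * n) + Real.pi * (n - 1 - j : ℕ) / n
      = Real.pi - (Real.pi / (2 * n) + Real.pi * j / n) := by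
    intro j hj
    have := Finset.mem_range.mp hj
    rw [Nat.sub_sub, Nat.cast_sub (by omega)]
    push_cast
    field_simp
    ring
  have hodd : ∀ F : ℕ → ℂ, (∀ j ∈ Finset.range n, F (n - 1 - j) = -F j) →
      ∑ j ∈ Finset.range n, F j = 0 := by
    intro F hF
    have h := Finset.sum_range_reflect F n
    rw [Finset.sum_congr rfl hF, Finset.sum_neg_distrib] at h
    linear_combination (-1 / 2) * h
  have h1 := hodd (fun j => Complex.cos (Real.pi / (2 * n) + Real.pi * j / n)
      / Complex.sin (Real.pi / (2 * n) + Real.pi * j / n) ^ 3)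
    fun j hj => by simp only [hrefl j hj, Complex.cos_pi_sub, Complex.sin_pi_sub, neg_div]
  have h2 := hodd (fun j => Complex.cos (Real.pi / (2 * n) + Real.pi * j / n)
      / Complex.sin (Real.pi / (2 * n) + Real.pi * j / n))
    fun j hj => by simp only [hrefl j hj, Complex.cos_pi_sub, Complex.sin_pi_sub, neg_div]
  have hs : Complex.sin (n * (Real.pi / (2 * n))) = 1 := by
    rw [show (n : ℂ) * (Real.pi / (2 * n)) = Real.pi / 2 by field_simp, Complex.sin_pi_div_two]
  have h3 := sum_inv_sin_sq_add hn (z := Real.pi / (2 * n)) (by rw [hs]; exact one_ne_zero)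
  rw [hs, one_pow, div_one] at h3
  simp only [singularPart, kernel, midpoint_angle hT t hn]
  rw [Finset.sum_add_distrib, Finset.sum_add_distrib, ← Finset.mul_sum, h1, ← Finset.mul_sum, h2,
    ← h3, Finset.mul_sum]
  simp [div_eq_mul_inv]

theorem sum_integrand_midpoint {T : ℝ} (hT : 0 < T) (t : ℝ) (u : ℂ → ℂ) {n : ℕ} (hn : 1 ≤ n) :
    ∑ j ∈ Finset.Icc 1 n, integrand T t u (t + j * (T / n) - T / n / 2)
      = ∑ j ∈ Finset.range n, subtracted T t u ((t + T / n / 2 + j * (T / n) : ℝ) : ℂ)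
        + T / Real.pi * deriv u t * (n : ℂ) ^ 2 := by
  have hI : Finset.Icc 1 n = Finset.Ico (0 + 1) (n + 1) := by
    ext j
    simp only [Finset.mem_Icc, Finset.mem_Ico]
    omega
  rw [hI, ← Finset.sum_Ico_add' _ 0 n 1, ← Finset.range_eq_Ico, ← sum_singularPart_midpoint hT t u hn,
    ← Finset.sum_add_distrib]
  refine Finset.sum_congr rfl fun j _ => ?_
  rw [show t + ((j + 1 : ℕ) : ℝ) * (T / n) - T / n / 2 = t + T / n / 2 + j * (T / n) by
    push_cast; ring]
  exact integrand_eq u (by rw [midpoint_angle hT t hn]; exact sin_midpoint_ne_zero hn j)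

/-- With g'(t) = (T/π)³ u'(t), the n²/3 part of the singular sum is cancelled by the g' term. The
remaining -1/3 and the g''' term make up h G(t), the value at the omitted node. -/
theorem quad0_eq {T : ℝ} (hT : 0 < T) {t : ℝ} {u : ℂ → ℂ} (hu : AnalyticAt ℂ u t) {n : ℕ}
    (hn : 1 ≤ n) : quad0 T t (integrand T t u) n
      = ((T / n : ℝ) : ℂ) * ∑ j ∈ Finset.range n, subtracted T t u ((t + j * (T / n) : ℝ) : ℂ) := by
  have hT' : (T : ℂ) ≠ 0 := by exact_mod_cast hT.ne'
  have hpi : (Real.pi : ℂ) ≠ 0 := by exact_mod_cast Real.pi_ne_zero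
  have hn0 : (n : ℂ) ≠ 0 := by exact_mod_cast (by omega : n ≠ 0)
  obtain ⟨hd1, hd3⟩ := derivs_regularFactor hT hu
  have hsum : ∑ j ∈ Finset.Ico 1 n, integrand T t u (t + j * (T / n))
      = ∑ j ∈ Finset.Ico 1 n, subtracted T t u ((t + j * (T / n) : ℝ) : ℂ)
        + T / Real.pi * deriv u t * (((n : ℂ) ^ 2 - 1) / 3) := by
    rw [← sum_singularPart_interior hT t u hn, ← Finset.sum_add_distrib]
    refine Finset.sum_congr rfl fun j hj => integrand_eq u ?_
    rw [show (Real.pi : ℂ) * (((t + j * (T / n) : ℝ) : ℂ) - t) / T = Real.pi * j / n by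
      push_cast; field_simp; ring]
    exact sin_interior_ne_zero hj
  have hG : subtracted T t u t
      = ((T : ℂ) / Real.pi) ^ 3 * (iteratedDeriv 3 u t / 6) - T / Real.pi * deriv u t / 3 :=
    if_pos (by simp)
  have hrange : ∑ j ∈ Finset.range n, subtracted T t u ((t + j * (T / n) : ℝ) : ℂ)
      = subtracted T t u t
        + ∑ j ∈ Finset.Ico 1 n, subtracted T t u ((t + j * (T / n) : ℝ) : ℂ) := by
    rw [Finset.range_eq_Ico, Finset.sum_eq_sum_Ico_succ_bot (by omega)]
    simp
  simp only [quad0]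
  rw [hsum, hd1, hd3, hrange, hG, Complex.ofReal_div, Complex.ofReal_natCast]
  generalize ∑ j ∈ Finset.Ico 1 n, subtracted T t u ((t + j * (T / n) : ℝ) : ℂ) = S
  field_simp
  ring

theorem quad1_eq {T : ℝ} (hT : 0 < T) {t : ℝ} {u : ℂ → ℂ} (hu : AnalyticAt ℂ u t) {n : ℕ}
    (hn : 1 ≤ n) : quad1 T t (integrand T t u) n = ((T / n : ℝ) : ℂ) *
      ∑ j ∈ Finset.range n, subtracted T t u ((t + T / n / 2 + j * (T / n) : ℝ) : ℂ) := by
  have hT' : (T : ℂ) ≠ 0 := by exact_mod_cast hT.ne'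
  have hpi : (Real.pi : ℂ) ≠ 0 := by exact_mod_cast Real.pi_ne_zero
  have hn0 : (n : ℂ) ≠ 0 := by exact_mod_cast (by omega : n ≠ 0)
  simp only [quad1]
  rw [sum_integrand_midpoint hT t u hn, (derivs_regularFactor hT hu).1, Complex.ofReal_div,
    Complex.ofReal_natCast]
  generalize ∑ j ∈ Finset.range n, subtracted T t u _ = S
  field_simp
  ring

/-- Halving h doubles the coefficient of g'(t)/h, so this combination is free of derivatives of g.
-/
theorem quad2_eq {T : ℝ} (hT : 0 < T) {t : ℝ} {u : ℂ → ℂ} {n : ℕ}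
    (hn : 1 ≤ n) : quad2 T t (integrand T t u) n
      = 2 * quad1 T t (integrand T t u) n - quad1 T t (integrand T t u) (2 * n) := by
  have hT' : (T : ℂ) ≠ 0 := by exact_mod_cast hT.ne'
  have hn0 : (n : ℂ) ≠ 0 := by exact_mod_cast (by omega : n ≠ 0)
  have e : ∀ j : ℕ, t + j * (T / n) / 2 - T / n / 4
      = t + j * (T / (2 * n : ℕ)) - T / (2 * n : ℕ) / 2 := by
    intro j
    push_cast
    ring
  simp only [quad1, quad2, e]
  generalize ∑ j ∈ Finset.Icc 1 (2 * n), integrand T t u _ = S₁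
  generalize ∑ j ∈ Finset.Icc 1 n, integrand T t u _ = S₂
  push_cast
  field_simp
  ring

/-! ### Maxima on horizontal lines and the error bounds. -/

/-- All zeros of sine and cosine are real, so off the real axis the literal formula for F₁ meets no
singularity. -/
theorem subtracted_eq_F1_line {T t : ℝ} (hT : 0 < T) (u : ℂ → ℂ) {y : ℝ} (hy : y ≠ 0) (x : ℝ) :
    F1 T t u (x + y * Complex.I) = subtracted T t u (x + y * Complex.I) := by
  have him : (Real.pi * ((x : ℂ) + y * Complex.I - t) / T).im ≠ 0 := by
    have e : (Real.pi * ((x : ℂ) + y * Complex.I - t) / T)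
        = ((Real.pi * (x - t) / T : ℝ) : ℂ) + ((Real.pi * y / T : ℝ) : ℂ) * Complex.I := by
      push_cast
      ring
    rw [e]
    simpa [Real.pi_ne_zero, hT.ne'] using hy
  refine (subtracted_eq_F1 (fun h => him ?_) fun h => him ?_).symm
  · obtain ⟨k, hk⟩ := Complex.sin_eq_zero_iff.mp h
    rw [hk]
    simp
  · obtain ⟨k, hk⟩ := Complex.cos_eq_zero_iff.mp h
    rw [hk, show (2 * (k : ℂ) + 1) * Real.pi / 2 = (((2 * k + 1) * Real.pi / 2 : ℝ) : ℂ) by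
      push_cast; ring]
    exact Complex.ofReal_im _

theorem isGreatest_lineMax {σ T y : ℝ} {F G : ℂ → ℂ} (hT : 0 < T)
    (hG : DifferentiableOn ℂ G (strip σ)) (hper : ∀ z ∈ strip σ, G (z + T) = G z) (hy : |y| < σ)
    (hFG : ∀ x : ℝ, F (x + y * Complex.I) = G (x + y * Complex.I)) :
    IsGreatest (range fun x : ℝ => ‖F (x + y * Complex.I)‖) (lineMax F y) := by
  have hc : Continuous fun x : ℝ => ‖F (x + y * Complex.I)‖ := by
    simpa only [hFG] using (continuous_line hG hy).norm
  have hp : Function.Periodic (fun x : ℝ => ‖F (x + y * Complex.I)‖) T := by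
    intro x
    simp only [hFG]
    rw [← hper (x + y * Complex.I) (by simpa [strip] using hy)]
    congr 2
    push_cast
    ring
  exact (hp.compact_of_continuous hT.ne' hc).isGreatest_sSup (range_nonempty _)

theorem phi_nonneg {T τ : ℝ} (hT : 0 < T) (hτ : 0 < τ) (n : ℕ) : 0 ≤ phi T n τ := by
  have hpi := Real.pi_pos
  have h : -2 * n * Real.pi * τ / T ≤ 0 := by
    have : 0 ≤ 2 * n * Real.pi * τ / T := by positivity
    have e : -2 * n * Real.pi * τ / T = -(2 * n * Real.pi * τ / T) := by ring
    linarith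
  exact div_nonneg (Real.exp_pos _).le (sub_nonneg.mpr (Real.exp_le_one_iff.mpr h))

/-- A common majorant for φₙ, φ₂ₙ and φ₄ₙ, whose denominator does not depend on n, for the
O-estimate. -/
theorem phi_le {T τ : ℝ} (hT : 0 < T) (hτ : 0 < τ) {m n : ℕ} (hn : 1 ≤ n) (hmn : n ≤ m) :
    phi T m τ ≤ Real.exp (-2 * n * Real.pi * τ / T) / (1 - Real.exp (-2 * Real.pi * τ / T)) := by
  have hpi := Real.pi_pos
  set c := 2 * Real.pi * τ / T with hc
  have hc0 : 0 < c := by positivity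
  have e : ∀ k : ℝ, -2 * k * Real.pi * τ / T = -(k * c) := fun k => by rw [hc]; ring
  have e1 : -2 * Real.pi * τ / T = -c := by rw [hc]; ring
  have hn' : (1 : ℝ) ≤ n := by exact_mod_cast hn
  have hm' : (n : ℝ) ≤ m := by exact_mod_cast hmn
  rw [phi, e, e, e1]
  refine div_le_div₀ (Real.exp_pos _).le (Real.exp_le_exp.mpr (by nlinarith))
    (sub_pos.mpr (Real.exp_lt_one_iff.mpr (by linarith)))
    (sub_le_sub_left (Real.exp_le_exp.mpr (by nlinarith)) _)

theorem theorem5p2 (a b t T σ : ℝ) (hat : a < t) (htb : t < b) (hT : T = b - a) (hσ : 0 < σ)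
    (u : ℂ → ℂ) (hu : AnalyticOnNhd ℂ u (strip σ))
    (hper : ∀ z ∈ strip σ, u (z + (T : ℂ)) = u z)
    (f : ℝ → ℂ) (hf : f = integrand T t u)
    (F₁ : ℂ → ℂ) (hF₁ : F₁ = F1 T t u) :
    -- `f(x) = g(x) / (x - t)³` with `g` smooth, and the finite part `I[f]` exists
    ContDiffOn ℝ ∞ (regularFactor f t) (Icc a b) ∧
    HasFinitePart f a b t (finitePart f a b t) ∧
    -- `F₁` is (up to its removable singularities) analytic and `T`-periodic in the strip
    (∃ G : ℂ → ℂ, AnalyticOnNhd ℂ G (strip σ) ∧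
      (∀ z ∈ strip σ, G (z + (T : ℂ)) = G z) ∧
      ∀ z ∈ strip σ, Complex.sin (Real.pi * (z - t) / T) ≠ 0 →
        Complex.cos (Real.pi * (z - t) / T) ≠ 0 → G z = F₁ z) ∧
    ∀ τ ∈ Ioo 0 σ,
      -- the two maxima in `M(τ)` are attained
      IsGreatest (range fun x : ℝ => ‖F₁ (x + τ * Complex.I)‖) (lineMax F₁ τ) ∧
      IsGreatest (range fun x : ℝ => ‖F₁ (x - τ * Complex.I)‖) (lineMax F₁ (-τ)) ∧
      (∀ n : ℕ, 1 ≤ n →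
        ‖quadError a b t f 0 n‖ ≤ T * M F₁ τ * phi T n τ ∧
        ‖quadError a b t f 1 n‖ ≤ T * M F₁ τ * (phi T n τ + 2 * phi T (2 * n) τ) ∧
        ‖quadError a b t f 2 n‖ ≤
          T * M F₁ τ * (2 * phi T n τ + 5 * phi T (2 * n) τ + 2 * phi T (4 * n) τ)) ∧
      ∀ s : Fin 3, quadError a b t f s =O[atTop]
        fun n : ℕ => Real.exp (-2 * n * Real.pi * τ / T) := by
  have hT0 : 0 < T := by linarith
  have hut : AnalyticAt ℂ u t := hu t (by simpa [strip] using hσ)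
  set G := subtracted T t u with hGdef
  have hG : AnalyticOnNhd ℂ G (strip σ) := analyticOnNhd_subtracted hT0 hσ hu hper
  have hGper : ∀ z ∈ strip σ, G (z + (T : ℂ)) = G z := fun z hz =>
    subtracted_add_period hT0 (hper z hz)
  have hFP : HasFinitePart f a b t (∫ x in a..b, G x) := by
    rw [hf, hGdef, hT]
    exact hasFinitePart_integrand hat htb hσ hu (by rwa [← hT])
  have hI := hFP.finitePart_eq
  refine ⟨?_, by rwa [hI], ⟨G, hG, hGper, fun z _ hs hc => ?_⟩, fun τ hτ => ?_⟩
  · rw [hf, hT]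
    exact contDiffOn_regularFactor hat htb hσ hu
  · rw [hF₁]
    exact subtracted_eq_F1 hs hc
  have hτ0 := hτ.1
  have hτσ : |τ| < σ := by rw [abs_of_pos hτ0]; exact hτ.2
  have hline : ∀ y : ℝ, y ≠ 0 → ∀ x : ℝ, F₁ (x + y * Complex.I) = G (x + y * Complex.I) :=
    fun y hy x => by rw [hF₁]; exact subtracted_eq_F1_line hT0 u hy x
  have hmax₁ := isGreatest_lineMax hT0 hG.differentiableOn hGper hτσ (hline τ hτ0.ne')
  have hmax₂ := isGreatest_lineMax hT0 hG.differentiableOn hGper (y := -τ) (by rwa [abs_neg])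
    (hline (-τ) (neg_ne_zero.mpr hτ0.ne'))
  have hM : 0 ≤ M F₁ τ :=
    add_nonneg ((norm_nonneg _).trans (hmax₁.2 ⟨0, rfl⟩)) ((norm_nonneg _).trans (hmax₂.2 ⟨0, rfl⟩))
  -- The starting node x is arbitrary, so one estimate covers the nodes t + jh and the midpoints.
  have htrap : ∀ n : ℕ, 1 ≤ n → ∀ x : ℝ, ‖((T / n : ℝ) : ℂ) *
      ∑ j ∈ Finset.range n, G ((x + j * (T / n) : ℝ) : ℂ) - ∫ y in a..b, G y‖
        ≤ T * M F₁ τ * phi T n τ := by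
    intro n hn x
    have := norm_trapezoid_sub_integral_le hT0 hG.differentiableOn hGper hτ
      (fun x => by rw [← hline τ hτ0.ne' x]; exact hmax₁.2 ⟨x, rfl⟩)
      (fun x => by
        rw [← hline (-τ) (neg_ne_zero.mpr hτ0.ne') x]
        exact hmax₂.2 ⟨x, rfl⟩) hn x a
    rwa [hT, add_sub_cancel, ← hT] at this
  have hE0 : ∀ n : ℕ, 1 ≤ n → ‖quadError a b t f 0 n‖ ≤ T * M F₁ τ * phi T n τ := by
    intro n hn
    have := htrap n hn t
    rw [← quad0_eq hT0 hut hn, ← hI, ← hf] at this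
    have e : quadError a b t f 0 n = quad0 T t f n - finitePart f a b t := by
      simp [quadError, hT]
    rwa [e]
  have hE1 : ∀ n : ℕ, 1 ≤ n →
      ‖quad1 T t f n - finitePart f a b t‖ ≤ T * M F₁ τ * phi T n τ := by
    intro n hn
    have := htrap n hn (t + T / n / 2)
    rwa [← quad1_eq hT0 hut hn, ← hI, ← hf] at this
  have hE1' : ∀ n : ℕ, quadError a b t f 1 n = quad1 T t f n - finitePart f a b t := by
    intro n
    simp [quadError, hT]
  have hE2' : ∀ n : ℕ, 1 ≤ n → quadError a b t f 2 n
      = 2 * (quad1 T t f n - finitePart f a b t)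
        - (quad1 T t f (2 * n) - finitePart f a b t) := by
    intro n hn
    have h : quadError a b t f 2 n = quad2 T t f n - finitePart f a b t := by
      simp [quadError, hT]
    rw [h, hf, quad2_eq hT0 hn]
    ring
  have hφ := fun n => phi_nonneg (n := n) hT0 hτ0
  have hTM : 0 ≤ T * M F₁ τ := mul_nonneg hT0.le hM
  have hbounds : ∀ n : ℕ, 1 ≤ n →
        ‖quadError a b t f 0 n‖ ≤ T * M F₁ τ * phi T n τ ∧
        ‖quadError a b t f 1 n‖ ≤ T * M F₁ τ * (phi T n τ + 2 * phi T (2 * n) τ) ∧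
        ‖quadError a b t f 2 n‖ ≤
          T * M F₁ τ * (2 * phi T n τ + 5 * phi T (2 * n) τ + 2 * phi T (4 * n) τ) := by
    intro n hn
    refine ⟨hE0 n hn, ?_, ?_⟩
    · rw [hE1']
      refine (hE1 n hn).trans (mul_le_mul_of_nonneg_left ?_ hTM)
      linarith [hφ (2 * n)]
    · rw [hE2' n hn]
      have h1 := hE1 n hn
      have h2 := hE1 (2 * n) (by omega)
      calc _ ≤ 2 * (T * M F₁ τ * phi T n τ) + T * M F₁ τ * phi T (2 * n) τ := by
            refine (norm_sub_le _ _).trans (add_le_add ?_ h2)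
            rw [norm_mul, Complex.norm_ofNat]
            linarith
        _ = T * M F₁ τ * (2 * phi T n τ + phi T (2 * n) τ) := by ring
        _ ≤ _ := by
            refine mul_le_mul_of_nonneg_left ?_ hTM
            linarith [hφ (2 * n), hφ (4 * n)]
  refine ⟨hmax₁, ?_, hbounds, fun s => ?_⟩
  · simpa only [Complex.ofReal_neg, neg_mul, ← sub_eq_add_neg] using hmax₂
  -- 9 = 2 + 5 + 2, the total weight in the largest of the three bounds.
  · refine Asymptotics.IsBigO.of_bound
      (T * M F₁ τ * 9 / (1 - Real.exp (-2 * Real.pi * τ / T))) ?_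
    filter_upwards [eventually_ge_atTop 1] with n hn
    have h1 := phi_le hT0 hτ0 hn le_rfl
    have h2 := phi_le hT0 hτ0 (m := 2 * n) hn (by omega)
    have h4 := phi_le hT0 hτ0 (m := 4 * n) hn (by omega)
    rw [Real.norm_of_nonneg (Real.exp_pos _).le]
    have hconv : T * M F₁ τ * 9 / (1 - Real.exp (-2 * Real.pi * τ / T))
        * Real.exp (-2 * n * Real.pi * τ / T) = T * M F₁ τ * (9 *
        (Real.exp (-2 * n * Real.pi * τ / T) / (1 - Real.exp (-2 * Real.pi * τ / T)))) := by ring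
    rw [hconv]
    obtain ⟨b0, b1, b2⟩ := hbounds n hn
    have hq := (hφ n).trans h1
    fin_cases s
    · exact b0.trans (mul_le_mul_of_nonneg_left (by linarith) hTM)
    · exact b1.trans (mul_le_mul_of_nonneg_left (by linarith) hTM)
    · exact b2.trans (mul_le_mul_of_nonneg_left (by linarith) hTM)
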